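/- Let $G$ be a locally compact, second countable, Hausdorff topological group, and let $P\subset G$ be a Borel subsemigroup with non-empty interior such that $PP^{-1}$ is a subgroup of $G$. Suppose that $P$ has an order unit, i.e. there is $a\in P$ such that for every $x\in P$ there are $n\in\{1,2,\dots\}$ and $b\in P$ with $a^n=xb$. Then every product system over $P$ is concrete. Here a product system over $P$ is a family $E=\{E(x)\}_{x\in P}$ of non-zero separable complex Hilbert spaces with an associative product on $\coprod_{x\in P}E(x)$ such that $uv\in E(xy)$ for $u\in E(x)$, $v\in E(y)$, and such that $u\otimes v\mapsto uv$ extends to a unitary operator $E(x)\otimes E(y)\to E(xy)$ for all $x,y\in P$, together with a set $\Gamma$ of sections for which $(E,\Gamma)$ is a measurable field of Hilbert spaces with $\Gamma$ as its space of measurable sections (that is: $x\mapsto\langle s(x)|t(x)\rangle$ is measurable for $s,t\in\Gamma$; every section $s$ such that $x\mapsto\langle s(x)|t(x)\rangle$ is measurable for all $t\in\Gamma$ belongs to $\Gamma$; and there is a sequence in $\Gamma$ whose values at $x$ span a dense subspace of $E(x)$, for every $x$), and such that $P\times P\ni(x,y)\mapsto\langle r(x)s(y)|t(xy)\rangle$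 is measurable for all $r,s,t\in\Gamma$. An $E_0$-semigroup over $P$ on $B(H)$, where $H$ is a non-zero separable Hilbert space, is a family $\alpha=\{\alpha_x\}_{x\in P}$ of unital normal $*$-endomorphisms of $B(H)$ with $\alpha_{xy}=\alpha_x\circ\alpha_y$ such that $x\mapsto\langle\alpha_x(A)\xi|\eta\rangle$ is measurable for all $A\in B(H)$ and $\xi,\eta\in H$. Its product system $E_\alpha$ has the fibres $E_\alpha(x)=\{T\in B(H):\alpha_x(A)T=TA\text{ for all }A\in B(H)\}$ with inner product given by $T^*S=\langle S|T\rangle 1$, the composition of operators as product, and the weakly measurable sections as measurable sections. A product system $E$ is concrete if it is isomorphic to $E_\alpha$ for some $E_0$-semigroup $\alpha$ over $P$, i.e. if there are unitary operators $\theta_x:E(x)\to E_\alpha(x)$, $x\in P$, such that $\theta_{xy}(uv)=\theta_x(u)\theta_y(v)$ for $u\in E(x)$, $v\in E(y)$, and such that $x\mapsto\theta_x(s(x))$ is a measurable section of $E_\alpha$ for every measurable section $s$ of $E$. -/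

import Mathlib

open scoped TensorProduct InnerProductSpace Pointwise
open UniformSpace (Completion)

noncomputable section

namespace ProdSys

universe u v w

/-- A field of inner product spaces `{E(x)}_{x ∈ P}` over a semigroup `P`, together with a
multiplication `E(x) × E(y) → E(xy)` on its disjoint union and a distinguished set `Γ` of sections.
These are only the data of a product system; the axioms are `IsProductSystem` below. -/
structure MulField (P : Type v) [Mul P] where
  /-- the fibre `E(x)` -/
  fiber : P → Type u
  [normed : ∀ x, NormedAddCommGroup (fiber x)]
  [innerProd : ∀ x, InnerProductSpace ℂ (fiber x)]
  /-- the multiplication `E(x) × E(y) → E(xy)` -/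
  mul : ∀ {x y : P}, fiber x → fiber y → fiber (x * y)
  /-- the distinguished set `Γ` of sections -/
  sections : Set (∀ x, fiber x)

attribute [instance] MulField.normed MulField.innerProd

section Axioms

variable {P : Type v} [Semigroup P]

/-- Algebraic product systems: the fibres are non-zero separable Hilbert spaces, the multiplication
of the disjoint union is associative, and it induces a unitary operator from the Hilbert space
tensor product `E(x) ⊗ E(y)` (the completion of the algebraic one) onto `E(xy)`. -/
structure IsAlgebraicProductSystem (E : MulField.{u} P) : Prop where
  complete : ∀ x, CompleteSpace (E.fiber x)
  separable : ∀ x, TopologicalSpace.SeparableSpace (E.fiber x)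
  nonzero : ∀ x, Nontrivial (E.fiber x)
  assoc : ∀ {x y z : P} (p : E.fiber x) (q : E.fiber y) (r : E.fiber z),
    (⟨x * y * z, E.mul (E.mul p q) r⟩ : Σ x, E.fiber x) = ⟨x * (y * z), E.mul p (E.mul q r)⟩
  unitary : ∀ x y : P, ∃ U : Completion (E.fiber x ⊗[ℂ] E.fiber y) ≃ₗᵢ[ℂ] E.fiber (x * y),
    ∀ (p : E.fiber x) (q : E.fiber y),
      U ((p ⊗ₜ[ℂ] q : E.fiber x ⊗[ℂ] E.fiber y) : Completion (E.fiber x ⊗[ℂ] E.fiber y))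
        = E.mul p q

/-- `({E(x)}, Γ)` is a measurable field of Hilbert spaces, with `Γ` its set of all
measurable sections. (That `Γ` is a linear space follows from `inner_measurable` and
`saturated`.) -/
structure IsMeasurableField [MeasurableSpace P] (E : MulField.{u} P) : Prop where
  inner_measurable : ∀ s ∈ E.sections, ∀ t ∈ E.sections,
    Measurable fun x => inner ℂ (s x) (t x)
  saturated : ∀ s : ∀ x, E.fiber x,
    (∀ t ∈ E.sections, Measurable fun x => inner ℂ (t x) (s x)) → s ∈ E.sections
  exists_total : ∃ e : ℕ → ∀ x, E.fiber x, (∀ n, e n ∈ E.sections) ∧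
    ∀ x, (Submodule.span ℂ (Set.range fun n => e n x)).topologicalClosure = ⊤

/-- Product systems over a measurable semigroup. -/
structure IsProductSystem [MeasurableSpace P] (E : MulField.{u} P) : Prop where
  algebraic : IsAlgebraicProductSystem E
  field : IsMeasurableField E
  mul_measurable : ∀ r ∈ E.sections, ∀ s ∈ E.sections, ∀ t ∈ E.sections,
    Measurable fun p : P × P => inner ℂ (t (p.1 * p.2)) (E.mul (r p.1) (s p.2))

/-- Isomorphism of product systems: a multiplicative measurable field of unitary operators. -/
def Isomorphic (E : MulField.{u} P) (F : MulField.{w} P) : Prop :=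
  ∃ θ : ∀ x, E.fiber x ≃ₗᵢ[ℂ] F.fiber x,
    (∀ (x y : P) (p : E.fiber x) (q : E.fiber y),
      θ (x * y) (E.mul p q) = F.mul (θ x p) (θ y q)) ∧
    ∀ s ∈ E.sections, (fun x => θ x (s x)) ∈ F.sections

end Axioms

section ESemigroups

variable {H : Type w} [NormedAddCommGroup H] [InnerProductSpace ℂ H]

/-- The `σ`-weak (ultraweak) topology of `B(H)`: the weakest topology that makes
`A ↦ ∑ₙ ⟨A ηₙ, ξₙ⟩` continuous for all square-summable sequences `ξ`, `η` in `H`. -/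
@[reducible] def ultraweakTopology (H : Type w) [NormedAddCommGroup H] [InnerProductSpace ℂ H] :
    TopologicalSpace (H →L[ℂ] H) :=
  ⨅ (ξ : lp (fun _ : ℕ => H) 2) (η : lp (fun _ : ℕ => H) 2),
    TopologicalSpace.induced (fun A : H →L[ℂ] H => ∑' n, inner ℂ (ξ n) (A (η n))) inferInstance

variable [CompleteSpace H]

/-- An `E₀`-semigroup over `P` on `B(H)`: a weakly measurable semigroup of unital normal
`*`-endomorphisms of `B(H)`. -/
structure E0Semigroup (P : Type v) [Semigroup P] [MeasurableSpace P]
    (H : Type w) [NormedAddCommGroup H] [InnerProductSpace ℂ H] [CompleteSpace H] where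
  toHom : P → (H →L[ℂ] H) →⋆ₐ[ℂ] (H →L[ℂ] H)
  normal : ∀ x, @Continuous _ _ (ultraweakTopology H) (ultraweakTopology H) (toHom x)
  map_mul : ∀ x y A, toHom (x * y) A = toHom x (toHom y A)
  measurable : ∀ (A : H →L[ℂ] H) (ξ η : H), Measurable fun x => inner ℂ η (toHom x A ξ)

/-- The intertwining space `{T ∈ B(H) : α(A) T = T A for all A ∈ B(H)}` of an endomorphism. -/
def intertwiners (α : (H →L[ℂ] H) →⋆ₐ[ℂ] (H →L[ℂ] H)) : Submodule ℂ (H →L[ℂ] H) where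
  carrier := {T | ∀ A, α A * T = T * A}
  add_mem' hS hT A := by rw [mul_add, add_mul, hS A, hT A]
  zero_mem' A := by simp
  smul_mem' c T hT A := by rw [mul_smul_comm, smul_mul_assoc, hT A]

/-- A unit vector of a non-zero Hilbert space. -/
def unitVector (H : Type w) [NormedAddCommGroup H] [InnerProductSpace ℂ H] [Nontrivial H] : H :=
  (exists_norm_eq H (zero_le_one (α := ℝ))).choose

theorem norm_unitVector (H : Type w) [NormedAddCommGroup H] [InnerProductSpace ℂ H]
    [Nontrivial H] : ‖unitVector H‖ = 1 :=
  (exists_norm_eq H (zero_le_one (α := ℝ))).choose_spec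

/-- For intertwiners `S`, `T` the operator `S* T` is a scalar. -/
theorem adjoint_mul_apply [Nontrivial H] (α : (H →L[ℂ] H) →⋆ₐ[ℂ] (H →L[ℂ] H))
    (S T : intertwiners α) (ξ : H) :
    (star (S : H →L[ℂ] H) * (T : H →L[ℂ] H)) ξ =
      inner ℂ ((S : H →L[ℂ] H) (unitVector H)) ((T : H →L[ℂ] H) (unitVector H)) • ξ := by
  have hcomm : ∀ A : H →L[ℂ] H, star (S : H →L[ℂ] H) * (T : H →L[ℂ] H) * A
      = A * (star (S : H →L[ℂ] H) * (T : H →L[ℂ] H)) := by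
    intro A
    have h1 := congrArg star (S.2 (star A))
    simp only [star_mul, map_star, star_star] at h1
    rw [mul_assoc, ← T.2 A, ← mul_assoc, h1, mul_assoc]
  set e := unitVector H with he
  have hn : inner ℂ e e = (1 : ℂ) := by
    rw [inner_self_eq_norm_sq_to_K, he, norm_unitVector]; simp
  have h := congrArg (fun B : H →L[ℂ] H => B e) (hcomm (InnerProductSpace.rankOne ℂ ξ e))
  simp only [mul_apply_eq_comp, InnerProductSpace.rankOne_apply, hn, one_smul] at h
  rw [mul_apply_eq_comp, h, ContinuousLinearMap.star_eq_adjoint,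
    ContinuousLinearMap.adjoint_inner_right]

theorem norm_intertwiner_apply [Nontrivial H] (α : (H →L[ℂ] H) →⋆ₐ[ℂ] (H →L[ℂ] H))
    (T : intertwiners α) : ‖T‖ = ‖(T : H →L[ℂ] H) (unitVector H)‖ := by
  have key : ∀ ξ, ‖(T : H →L[ℂ] H) ξ‖ = ‖(T : H →L[ℂ] H) (unitVector H)‖ * ‖ξ‖ := by
    intro ξ
    have h := congrArg (fun ζ => inner ℂ ξ ζ) (adjoint_mul_apply α T T ξ)
    simp only [mul_apply_eq_comp, ContinuousLinearMap.star_eq_adjoint,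
      ContinuousLinearMap.adjoint_inner_right, inner_smul_right] at h
    simp only [inner_self_eq_norm_sq_to_K] at h
    have h' : ‖(T : H →L[ℂ] H) ξ‖ ^ 2 = (‖(T : H →L[ℂ] H) (unitVector H)‖ * ‖ξ‖) ^ 2 := by
      rw [mul_pow]; exact_mod_cast h
    exact (sq_eq_sq₀ (norm_nonneg _) (by positivity)).1 h'
  refine le_antisymm ?_ ?_
  · exact ContinuousLinearMap.opNorm_le_bound _ (norm_nonneg _) fun ξ => (key ξ).le
  · have := (T : H →L[ℂ] H).le_opNorm (unitVector H)
    rwa [norm_unitVector, mul_one] at this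

/-- The inner product of the intertwining space, with the operator norm as its norm. It is
characterized by `S* T = ⟪S, T⟫ 1`, see `adjoint_mul_eq_inner`. -/
instance intertwinersInner [Nontrivial H] (α : (H →L[ℂ] H) →⋆ₐ[ℂ] (H →L[ℂ] H)) :
    InnerProductSpace ℂ (intertwiners α) where
  inner S T := inner ℂ ((S : H →L[ℂ] H) (unitVector H)) ((T : H →L[ℂ] H) (unitVector H))
  norm_sq_eq_re_inner T := by
    rw [norm_intertwiner_apply, inner_self_eq_norm_sq_to_K]
    norm_cast
  conj_inner_symm S T := inner_conj_symm _ _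
  add_left R S T := inner_add_left _ _ _
  smul_left S T c := inner_smul_left _ _ _

theorem adjoint_mul_eq_inner [Nontrivial H] (α : (H →L[ℂ] H) →⋆ₐ[ℂ] (H →L[ℂ] H))
    (S T : intertwiners α) :
    star (S : H →L[ℂ] H) * (T : H →L[ℂ] H) = inner ℂ S T • (1 : H →L[ℂ] H) :=
  ContinuousLinearMap.ext fun ξ => adjoint_mul_apply α S T ξ

/-- The product system associated with an `E₀`-semigroup: its fibres are the intertwining spaces,
its product is the composition of operators, its measurable sections are the weakly measurable
ones. -/
def E0Semigroup.productSystem {P : Type v} [Semigroup P] [MeasurableSpace P] [Nontrivial H]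
    (α : E0Semigroup P H) : MulField.{w} P where
  fiber x := intertwiners (α.toHom x)
  mul {x y} S T := ⟨(S : H →L[ℂ] H) * (T : H →L[ℂ] H), fun A => by
    rw [α.map_mul, ← mul_assoc, S.2, mul_assoc, T.2, mul_assoc]⟩
  sections := {f | ∀ ξ η : H, Measurable fun x => inner ℂ η ((f x : H →L[ℂ] H) ξ)}

end ESemigroups

/-- A product system is concrete if it is isomorphic to the product system of an `E₀`-semigroup on
`B(H)` for a (non-zero) separable Hilbert space `H`. Every separable Hilbert space is unitarily
equivalent to one in `Type`. -/
def IsConcrete {P : Type v} [Semigroup P] [MeasurableSpace P] (E : MulField.{u} P) : Prop :=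
  ∃ (H : Type) (_ : NormedAddCommGroup H) (_ : InnerProductSpace ℂ H) (_ : CompleteSpace H)
    (_ : TopologicalSpace.SeparableSpace H) (_ : Nontrivial H) (α : E0Semigroup P H),
    Isomorphic E α.productSystem

/-- `a` is an order unit of the subsemigroup `P`: `a ∈ P`, and for every `x ∈ P` there is `n ≥ 1`
with `x ≤ aⁿ`, i.e. `aⁿ ∈ x P`. -/
def IsOrderUnit {G : Type v} [Group G] (P : Subsemigroup G) (a : G) : Prop :=
  a ∈ P ∧ ∀ x ∈ P, ∃ n : ℕ, 1 ≤ n ∧ ∃ b ∈ P, a ^ n = x * b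

end ProdSys

end

/-!
# Product systems over semigroups with an order unit are concrete

A *representation* of a product system `E` on a Hilbert space `H` assigns to `u ∈ E(x)` an operator
`φ(u)` such that `φ(u)* φ(v) = ⟪u, v⟫ 1` and `φ(uv) = φ(u) φ(v)`. If it is nondegenerate, meaning
that `φ(E(x)) H` is total in `H` for every `x`, then `H` is the tensor product of `E(x)` and `H`,
and `α_x(A) = 1 ⊗ A = ∑ₙ φ(bₙ(x)) A φ(bₙ(x))*`, for a measurable field `(bₙ)` of orthonormal bases,
is an `E₀`-semigroup whose intertwiners over `x` are exactly the operators `φ(u)`, `u ∈ E(x)`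
(`Rep.e0Semigroup`, `IsTensor.exists_eq_of_mem_intertwiners`, `Rep.isConcrete`). So it suffices to
find a nondegenerate representation on a non-zero separable Hilbert space.

Left Haar measure of the group, restricted to `P`, is left invariant, so left multiplication
`(φ(u) s)(xy) = u s(y)`, with value zero off `xP`, represents `E` on the square-integrable sections
of `E` over `P` (`leftRep`). This representation is degenerate in general: the range of `φ(E(x))`
spans only the sections carried by `xP` (`exists_span_norm_sub_lt`). The remedy uses the order unit
`a`. The image of Haar measure under right translation by `a` is a multiple `c` of it, so for
`e ∈ E(a)` with `‖e‖² = c` the formula `(J s)(ya) = s(y) e`, with value zero off `Pa`, defines an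
isometry `J` (`rightIsometry`), and `J` commutes with every `φ(u)` by associativity. Hence `φ`
extends to the direct limit of the space along `J` (`DirLim`, `Rep.dirLim`). In this limit a section
`s` at one level is identified with `Jⁿ s` at the level `n` steps later, and the mass of `Jⁿ s` off
`xP` is that of `s` on `{y | y aⁿ ∉ xP}`. Since `PP⁻¹` is a group and `a` is an order unit, every
`y` satisfies `y aⁿ ∈ xP` for all large `n` (`eventually_iterate_mem_range`), so by dominated
convergence this mass tends to zero (`tendsto_integral_rightIsometry_pow`). Thus the limit
representation is nondegenerate.

Non-empty interior of `P` makes the restricted Haar measure non-zero, hence the limit space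
non-zero (`exists_norm_ne_zero_L2Section`); separability follows from expanding sections along
`(bₙ)`, which embeds them into the scalar `L²` space of `P × ℕ` (`separableSpace_L2Section`).

Spaces of sections and the direct limit are kept as semi-inner product spaces of functions and
sequences; completion takes place once, at the end (`Rep.isConcrete_of_separable`).
-/

noncomputable section

namespace ProdSys

open Filter Topology MeasureTheory

universe u v w

/-! ### Orthonormal bases with zeros and Hilbert space tensor products -/

section Hilbert

variable {X Y Z : Type*}
  [NormedAddCommGroup X] [InnerProductSpace ℂ X]
  [NormedAddCommGroup Y] [InnerProductSpace ℂ Y]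
  [NormedAddCommGroup Z] [InnerProductSpace ℂ Z]

/-- A sequence of pairwise orthogonal vectors, each a unit vector or zero, with dense span: an
orthonormal basis in which zeros are allowed, so that one index set serves all fibres of a field of
Hilbert spaces. -/
structure IsPaddedBasis (b : ℕ → X) : Prop where
  orthogonal : ∀ m n, m ≠ n → ⟪b m, b n⟫_ℂ = 0
  norm_eq_one : ∀ n, b n ≠ 0 → ‖b n‖ = 1
  dense : (Submodule.span ℂ (Set.range b)).topologicalClosure = ⊤

theorem isPaddedBasis_gramSchmidtNormed {e : ℕ → X}
    (he : (Submodule.span ℂ (Set.range e)).topologicalClosure = ⊤) :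
    IsPaddedBasis (InnerProductSpace.gramSchmidtNormed ℂ e) where
  orthogonal m n h := by
    simp only [InnerProductSpace.gramSchmidtNormed, inner_smul_left, inner_smul_right,
      InnerProductSpace.gramSchmidt_orthogonal ℂ e h, mul_zero]
  norm_eq_one n h := InnerProductSpace.gramSchmidtNormed_unit_length' h
  dense := by
    rw [InnerProductSpace.span_gramSchmidtNormed_range, InnerProductSpace.span_gramSchmidt, he]

/-- A bilinear map `(u, y) ↦ B u y` that extends to a unitary operator from the Hilbert space tensor
product of `X` and `Y` onto `Z`, expressed without the tensor product. -/
structure IsTensor (B : X →ₗ[ℂ] Y →L[ℂ] Z) : Prop where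
  inner_eq : ∀ u v y z, ⟪B u y, B v z⟫_ℂ = ⟪u, v⟫_ℂ * ⟪y, z⟫_ℂ
  dense : (Submodule.span ℂ (Set.range fun p : X × Y => B p.1 p.2)).topologicalClosure = ⊤

theorem IsTensor.norm_apply {B : X →ₗ[ℂ] Y →L[ℂ] Z} (hB : IsTensor B) (u : X) (y : Y) :
    ‖B u y‖ = ‖u‖ * ‖y‖ := by
  have h := hB.inner_eq u u y y
  simp only [inner_self_eq_norm_sq_to_K] at h
  have h' : ‖B u y‖ ^ 2 = (‖u‖ * ‖y‖) ^ 2 := by rw [mul_pow]; exact_mod_cast h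
  exact (sq_eq_sq₀ (norm_nonneg _) (by positivity)).1 h'

theorem IsTensor.continuous_left {B : X →ₗ[ℂ] Y →L[ℂ] Z} (hB : IsTensor B) (y : Y) :
    Continuous fun u => B u y := by
  let L : X →ₗ[ℂ] Z :=
    { toFun := fun u => B u y
      map_add' := fun u v => by simp
      map_smul' := fun c u => by simp }
  exact (L.mkContinuous ‖y‖ fun u => by rw [mul_comm]; exact (hB.norm_apply u y).le).continuous

/-- Vectors of a tensor product are determined by their inner products with elementary tensors. -/
theorem IsTensor.eq_of_adjoint_eq {B : X →ₗ[ℂ] Y →L[ℂ] Z} (hB : IsTensor B) {z z' : Z}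
    (h : ∀ u y, ⟪B u y, z⟫_ℂ = ⟪B u y, z'⟫_ℂ) : z = z' := by
  rw [← sub_eq_zero]
  have hd : Dense (Submodule.span ℂ (Set.range fun p : X × Y => B p.1 p.2) : Set Z) :=
    (Submodule.dense_iff_topologicalClosure_eq_top).2 hB.dense
  refine hd.eq_zero_of_inner_right ℂ (fun v hv => ?_)
  induction hv using Submodule.span_induction with
  | mem x hx => obtain ⟨p, rfl⟩ := hx; simp [inner_sub_right, h]
  | zero => simp
  | add x y _ _ hx hy => rw [inner_add_left, hx, hy, add_zero]
  | smul c x _ hx => rw [inner_smul_left, hx, mul_zero]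

/-- Continuous linear maps that agree on elementary tensors are equal. -/
theorem IsTensor.clm_ext {B : X →ₗ[ℂ] Y →L[ℂ] Z} (hB : IsTensor B) {W : Type*}
    [NormedAddCommGroup W] [InnerProductSpace ℂ W] {S T : Z →L[ℂ] W}
    (h : ∀ u y, S (B u y) = T (B u y)) : S = T := by
  refine ContinuousLinearMap.ext_on (Submodule.dense_iff_topologicalClosure_eq_top.2 hB.dense) ?_
  rintro _ ⟨p, rfl⟩
  exact h _ _

/-- A Hilbert space is its own tensor product with the scalars. -/
theorem isTensor_smulRight : IsTensor
    ({ toFun := fun x : X => ContinuousLinearMap.toSpanSingleton ℂ x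
       map_add' := fun x y => by ext; simp
       map_smul' := fun c x => by ext; simp } : X →ₗ[ℂ] ℂ →L[ℂ] X) where
  inner_eq u v y z := by
    simp; ring
  dense := by
    refine Submodule.eq_top_iff'.2 fun x => Submodule.le_topologicalClosure _ ?_
    exact Submodule.subset_span ⟨(x, 1), by simp⟩

variable [CompleteSpace Y] [CompleteSpace Z]

theorem IsTensor.adjoint_apply {B : X →ₗ[ℂ] Y →L[ℂ] Z} (hB : IsTensor B) (u v : X) (y : Y) :
    ContinuousLinearMap.adjoint (B u) (B v y) = ⟪u, v⟫_ℂ • y := by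
  refine ext_inner_left ℂ fun z => ?_
  rw [ContinuousLinearMap.adjoint_inner_right, hB.inner_eq, inner_smul_right]

/-- The ranges of the isometries `B (b n)` decompose `Z` orthogonally. -/
theorem IsTensor.hasSum {B : X →ₗ[ℂ] Y →L[ℂ] Z} (hB : IsTensor B) {b : ℕ → X}
    (hb : IsPaddedBasis b) (z : Z) :
    HasSum (fun n => B (b n) (ContinuousLinearMap.adjoint (B (b n)) z)) z := by
  let ι := {n : ℕ // b n ≠ 0}
  let V : ∀ _ : ι, Y →ₗᵢ[ℂ] Z := fun i =>
    { toLinearMap := (B (b i)).toLinearMap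
      norm_map' := fun y => by
        have := hB.norm_apply (b i) y
        rw [hb.norm_eq_one _ i.2, one_mul] at this
        exact this }
  have hV : OrthogonalFamily ℂ (fun _ : ι => Y) V := by
    intro i j hij y z
    change ⟪B (b i) y, B (b j) z⟫_ℂ = 0
    rw [hB.inner_eq, hb.orthogonal _ _ fun h => hij (Subtype.ext h), zero_mul]
  have hsum : IsHilbertSum ℂ (fun _ : ι => Y) V := by
    refine IsHilbertSum.mk hV ?_
    rw [← hB.dense]
    refine Submodule.topologicalClosure_minimal _ (Submodule.span_le.2 ?_)
      (Submodule.isClosed_topologicalClosure _)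
    rintro _ ⟨⟨u, y⟩, rfl⟩
    set W := (⨆ i, LinearMap.range (V i).toLinearMap).topologicalClosure
    have hu : u ∈ (Submodule.span ℂ (Set.range b)).topologicalClosure := by rw [hb.dense]; trivial
    have hcl : IsClosed {u : X | B u y ∈ W} :=
      (Submodule.isClosed_topologicalClosure _).preimage (hB.continuous_left y)
    refine closure_minimal (s := (Submodule.span ℂ (Set.range b) : Set X)) ?_ hcl hu
    intro u hu
    induction hu using Submodule.span_induction with
    | mem x hx =>
      obtain ⟨n, rfl⟩ := hx
      by_cases hn : b n = 0
      · simp [hn]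
      · exact Submodule.le_topologicalClosure _
          (Submodule.mem_iSup_of_mem (⟨n, hn⟩ : ι) ⟨y, rfl⟩)
    | zero => simp
    | add x y _ _ hx hy => simpa using add_mem hx hy
    | smul c x _ hx => simpa using Submodule.smul_mem _ c hx
  -- expand `z` along the ranges and apply `B (b i)*` to identify the coefficients
  have h1 := hsum.hasSum_linearIsometryEquiv_symm (hsum.linearIsometryEquiv z)
  rw [LinearIsometryEquiv.symm_apply_apply] at h1
  set c := hsum.linearIsometryEquiv z
  have hc : ∀ i : ι, c i = ContinuousLinearMap.adjoint (B (b i)) z := by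
    intro i
    have h2 := (ContinuousLinearMap.adjoint (B (b i))).hasSum h1
    have h3 : ∀ j : ι, ContinuousLinearMap.adjoint (B (b i)) (V j (c j)) = ⟪b i, b j⟫_ℂ • c j :=
      fun j => hB.adjoint_apply _ _ _
    refine HasSum.unique ?_ h2
    convert hasSum_single i ?_
    · simp only [h3]
      rw [inner_self_eq_norm_sq_to_K, hb.norm_eq_one _ i.2]; simp
    · intro j hj
      simp only [h3]
      rw [hb.orthogonal _ _ fun h => hj (Subtype.ext h.symm), zero_smul]
  have h4 : HasSum ((fun n => B (b n) (ContinuousLinearMap.adjoint (B (b n)) z)) ∘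
      (Subtype.val : ι → ℕ)) z := by
    convert h1 using 1
    funext i
    simp only [Function.comp, ← hc]
    rfl
  refine (hasSum_subtype_iff_of_support_subset (s := {n | b n ≠ 0}) ?_).1 h4
  intro n hn h0
  simp [h0] at hn

theorem IsTensor.hasSum_inner {B : X →ₗ[ℂ] Y →L[ℂ] Z} (hB : IsTensor B) {b : ℕ → X}
    (hb : IsPaddedBasis b) (z z' : Z) :
    HasSum (fun n => ⟪ContinuousLinearMap.adjoint (B (b n)) z,
      ContinuousLinearMap.adjoint (B (b n)) z'⟫_ℂ) ⟪z, z'⟫_ℂ := by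
  have h := (innerSL ℂ z).hasSum (hB.hasSum hb z')
  refine h.congr_fun fun n => ?_
  rw [ContinuousLinearMap.adjoint_inner_left]
  rfl

theorem IsTensor.hasSum_norm_sq {B : X →ₗ[ℂ] Y →L[ℂ] Z} (hB : IsTensor B) {b : ℕ → X}
    (hb : IsPaddedBasis b) (z : Z) :
    HasSum (fun n => ‖ContinuousLinearMap.adjoint (B (b n)) z‖ ^ 2) (‖z‖ ^ 2) := by
  have h := hB.hasSum_inner hb z z
  simpa [Function.comp_def, inner_self_eq_norm_sq_to_K, ← Complex.ofReal_pow] using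
    Complex.reCLM.hasSum h

theorem IsTensor.memℓp_coords {B : X →ₗ[ℂ] Y →L[ℂ] Z} (hB : IsTensor B) {b : ℕ → X}
    (hb : IsPaddedBasis b) (z : Z) :
    Memℓp (fun n => ContinuousLinearMap.adjoint (B (b n)) z) 2 := by
  refine memℓp_gen ?_
  simpa using (hB.hasSum_norm_sq hb z).summable

/-- Bessel's inequality for the decomposition of a tensor product. -/
theorem IsTensor.norm_sum_le {B : X →ₗ[ℂ] Y →L[ℂ] Z} (hB : IsTensor B) {b : ℕ → X}
    (hb : IsPaddedBasis b) (I : Finset ℕ) (z : Z) :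
    ‖∑ n ∈ I, B (b n) (ContinuousLinearMap.adjoint (B (b n)) z)‖ ≤ ‖z‖ := by
  set q := ∑ n ∈ I, B (b n) (ContinuousLinearMap.adjoint (B (b n)) z) with hq
  -- `q` is an orthogonal projection of `z`, that is `⟪q, q⟫ = ⟪q, z⟫`
  have hadj : ∀ n ∈ I, ContinuousLinearMap.adjoint (B (b n)) q
      = ⟪b n, b n⟫_ℂ • ContinuousLinearMap.adjoint (B (b n)) z := by
    intro n hn
    rw [hq, map_sum, Finset.sum_eq_single n]
    · rw [hB.adjoint_apply]
    · intro m _ hm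
      rw [hB.adjoint_apply, hb.orthogonal _ _ hm.symm, zero_smul]
    · exact fun h => absurd hn h
  have hqq : ⟪q, q⟫_ℂ = ⟪z, q⟫_ℂ := by
    have h : ∀ p : Z, ⟪p, q⟫_ℂ = ∑ n ∈ I, ⟪ContinuousLinearMap.adjoint (B (b n)) p,
        ContinuousLinearMap.adjoint (B (b n)) z⟫_ℂ := fun p => by
      rw [hq, inner_sum]
      simp only [ContinuousLinearMap.adjoint_inner_left]
    rw [h q, h z]
    refine Finset.sum_congr rfl fun n hn => ?_
    rw [hadj n hn]
    by_cases h0 : b n = 0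
    · simp [h0]
    · rw [inner_self_eq_norm_sq_to_K (b n), hb.norm_eq_one n h0]; simp
  have h1 : ‖q‖ ^ 2 ≤ ‖z‖ * ‖q‖ := by
    have h := norm_inner_le_norm (𝕜 := ℂ) z q
    rw [← hqq, inner_self_eq_norm_sq_to_K] at h
    simpa using h
  nlinarith [norm_nonneg q, norm_nonneg z]

/-- The isometry `z ↦ (B (b n)* z)ₙ` from `Z` to the `ℓ²`-sum of copies of `Y`. -/
def IsTensor.coords {B : X →ₗ[ℂ] Y →L[ℂ] Z} (hB : IsTensor B) {b : ℕ → X}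
    (hb : IsPaddedBasis b) : Z →L[ℂ] lp (fun _ : ℕ => Y) 2 :=
  LinearMap.mkContinuous
    { toFun := fun z =>
        ⟨fun n => ContinuousLinearMap.adjoint (B (b n)) z, hB.memℓp_coords hb z⟩
      map_add' := fun z z' => by ext n; exact map_add _ z z'
      map_smul' := fun c z => by ext n; exact map_smul _ c z } 1 fun z => by
    refine le_of_sq_le_sq ?_ (by positivity)
    have h := lp.norm_rpow_eq_tsum (p := 2) (by simp)
      (⟨_, hB.memℓp_coords hb z⟩ : lp (fun _ : ℕ => Y) 2)
    simp only [ENNReal.toReal_ofNat, Real.rpow_ofNat, (hB.hasSum_norm_sq hb z).tsum_eq] at h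
    rw [one_mul]
    exact h.le

@[simp]
theorem IsTensor.coords_apply {B : X →ₗ[ℂ] Y →L[ℂ] Z} (hB : IsTensor B) {b : ℕ → X}
    (hb : IsPaddedBasis b) (z : Z) (n : ℕ) :
    hB.coords hb z n = ContinuousLinearMap.adjoint (B (b n)) z := rfl

/-- The operator `1 ⊗ A` on the tensor product `Z` of `X` and `Y`. It is defined in coordinates with
respect to a basis of `X` but does not depend on it, by `IsTensor.ampl_apply`. -/
def IsTensor.ampl {B : X →ₗ[ℂ] Y →L[ℂ] Z} (hB : IsTensor B) {b : ℕ → X}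
    (hb : IsPaddedBasis b) (A : Y →L[ℂ] Y) : Z →L[ℂ] Z :=
  ContinuousLinearMap.adjoint (hB.coords hb) ∘L
    lp.mapCLM 2 (fun _ : ℕ => A) (norm_nonneg A) (fun _ => le_rfl) ∘L hB.coords hb

theorem IsTensor.hasSum_inner_ampl {B : X →ₗ[ℂ] Y →L[ℂ] Z} (hB : IsTensor B) {b : ℕ → X}
    (hb : IsPaddedBasis b) (A : Y →L[ℂ] Y) (z z' : Z) :
    HasSum (fun n => ⟪ContinuousLinearMap.adjoint (B (b n)) z,
      A (ContinuousLinearMap.adjoint (B (b n)) z')⟫_ℂ) ⟪z, hB.ampl hb A z'⟫_ℂ := by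
  have h := lp.hasSum_inner (𝕜 := ℂ) (hB.coords hb z)
    (lp.mapCLM 2 (fun _ : ℕ => A) (norm_nonneg A) (fun _ => le_rfl) (hB.coords hb z'))
  simpa [IsTensor.ampl, ContinuousLinearMap.adjoint_inner_right] using h

theorem IsTensor.ampl_apply {B : X →ₗ[ℂ] Y →L[ℂ] Z} (hB : IsTensor B) {b : ℕ → X}
    (hb : IsPaddedBasis b) (A : Y →L[ℂ] Y) (u : X) (y : Y) :
    hB.ampl hb A (B u y) = B u (A y) := by
  refine ext_inner_left ℂ fun z => ?_
  refine (hB.hasSum_inner_ampl hb A z (B u y)).unique ?_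
  convert hB.hasSum_inner hb z (B u (A y)) using 3 with n
  rw [hB.adjoint_apply, hB.adjoint_apply, map_smul]

end Hilbert

/-- Parseval's identity, as the case `Y = ℂ` of the decomposition of a tensor product. -/
theorem IsPaddedBasis.hasSum_inner {X : Type*} [NormedAddCommGroup X] [InnerProductSpace ℂ X]
    [CompleteSpace X] {b : ℕ → X} (hb : IsPaddedBasis b)
    (z z' : X) : HasSum (fun n => ⟪z, b n⟫_ℂ * ⟪b n, z'⟫_ℂ) ⟪z, z'⟫_ℂ := by
  convert isTensor_smulRight.hasSum_inner hb z z' using 2 with n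
  have : ∀ x : X, ContinuousLinearMap.adjoint (ContinuousLinearMap.toSpanSingleton ℂ (b n)) x
      = ⟪b n, x⟫_ℂ := by
    intro x
    refine ext_inner_left ℂ fun z => ?_
    rw [ContinuousLinearMap.adjoint_inner_right]
    simp [inner_smul_left, mul_comm]
  simp [this, mul_comm]

theorem IsPaddedBasis.hasSum_norm_sq {X : Type*} [NormedAddCommGroup X]
    [InnerProductSpace ℂ X] [CompleteSpace X] {b : ℕ → X} (hb : IsPaddedBasis b)
    (z : X) : HasSum (fun n => ‖⟪b n, z⟫_ℂ‖ ^ 2) (‖z‖ ^ 2) := by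
  have h := hb.hasSum_inner z z
  simp only [inner_self_eq_norm_sq_to_K] at h
  have h2 : ∀ n, ⟪z, b n⟫_ℂ * ⟪b n, z⟫_ℂ = ((‖⟪b n, z⟫_ℂ‖ ^ 2 : ℝ) : ℂ) := by
    intro n
    rw [← inner_conj_symm, RCLike.conj_mul]; simp
  simp only [h2] at h
  simpa [Function.comp_def, ← Complex.ofReal_pow] using Complex.reCLM.hasSum h

/-! ### Ampliations -/

section Ampliation

variable {X Y Z : Type*}
  [NormedAddCommGroup X] [InnerProductSpace ℂ X]
  [NormedAddCommGroup Y] [InnerProductSpace ℂ Y]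
  [NormedAddCommGroup Z] [InnerProductSpace ℂ Z]
  [CompleteSpace Y] [CompleteSpace Z]
  {B : X →ₗ[ℂ] Y →L[ℂ] Z} (hB : IsTensor B) {b : ℕ → X} (hb : IsPaddedBasis b)

/-- The ampliation `A ↦ 1 ⊗ A` as a `*`-homomorphism. -/
def IsTensor.amplHom : (Y →L[ℂ] Y) →⋆ₐ[ℂ] (Z →L[ℂ] Z) where
  toFun := hB.ampl hb
  map_one' := hB.clm_ext fun u y => by simp [hB.ampl_apply]
  map_mul' A A' := hB.clm_ext fun u y => by simp [hB.ampl_apply]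
  map_zero' := hB.clm_ext fun u y => by simp [hB.ampl_apply]
  map_add' A A' := hB.clm_ext fun u y => by simp [hB.ampl_apply]
  commutes' c := hB.clm_ext fun u y => by
    simp [hB.ampl_apply, Algebra.algebraMap_eq_smul_one]
  map_star' A := by
    refine ContinuousLinearMap.ext fun z' => ext_inner_left ℂ fun z => ?_
    refine (hB.hasSum_inner_ampl hb (star A) z z').unique ?_
    rw [ContinuousLinearMap.star_eq_adjoint, ContinuousLinearMap.star_eq_adjoint,
      ContinuousLinearMap.adjoint_inner_right, ← inner_conj_symm]
    refine ((Complex.hasSum_conj' ).2 (hB.hasSum_inner_ampl hb A z' z)).congr_fun fun n => ?_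
    rw [ContinuousLinearMap.adjoint_inner_right, inner_conj_symm]

theorem IsTensor.amplHom_apply (A : Y →L[ℂ] Y) (u : X) (y : Y) :
    hB.amplHom hb A (B u y) = B u (A y) := hB.ampl_apply hb A u y

/-- The square-summable double sequence `(k, n) ↦ B (b n)* (ξ k)`, enumerated by `ℕ`. -/
def IsTensor.pairCoords (ξ : lp (fun _ : ℕ => Z) 2) : lp (fun _ : ℕ => Y) 2 :=
  ⟨fun m => ContinuousLinearMap.adjoint (B (b m.unpair.2)) (ξ m.unpair.1), by
    refine memℓp_gen ?_
    simp only [ENNReal.toReal_ofNat, Real.rpow_ofNat]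
    refine (Nat.pairEquiv.summable_iff (f := fun m : ℕ =>
      ‖ContinuousLinearMap.adjoint (B (b m.unpair.2)) (ξ m.unpair.1)‖ ^ 2)).1 ?_
    have h0 : Summable fun k => ‖ξ k‖ ^ 2 := by
      simpa using (lp.memℓp ξ).summable (by simp)
    refine (summable_prod_of_nonneg fun _ => sq_nonneg _).2 ⟨fun k => ?_, ?_⟩
    · simpa only [Function.comp, Nat.pairEquiv_apply, Function.uncurry, Nat.unpair_pair] using
        (hB.hasSum_norm_sq hb (ξ k)).summable
    · simpa only [Function.comp, Nat.pairEquiv_apply, Function.uncurry, Nat.unpair_pair,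
        (hB.hasSum_norm_sq hb (ξ _)).tsum_eq] using h0⟩

/-- An ampliation pulls the functional of two square-summable sequences back to the functional of
their coordinate sequences. -/
theorem IsTensor.tsum_inner_amplHom (ξ η : lp (fun _ : ℕ => Z) 2) (A : Y →L[ℂ] Y) :
    ∑' k, ⟪ξ k, hB.amplHom hb A (η k)⟫_ℂ
      = ∑' m, ⟪hB.pairCoords hb ξ m, A (hB.pairCoords hb η m)⟫_ℂ := by
  have hs : Summable fun m => ⟪hB.pairCoords hb ξ m, A (hB.pairCoords hb η m)⟫_ℂ :=
    lp.summable_inner (𝕜 := ℂ) (hB.pairCoords hb ξ)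
      (lp.mapCLM 2 (fun _ : ℕ => A) (norm_nonneg A) (fun _ => le_rfl) (hB.pairCoords hb η))
  refine Eq.trans ?_ (Nat.pairEquiv.tsum_eq _)
  refine Eq.trans (tsum_congr fun k => ?_) (((Nat.pairEquiv.summable_iff).2 hs).tsum_prod).symm
  refine ((hB.hasSum_inner_ampl hb A (ξ k) (η k)).congr_fun fun n => ?_).tsum_eq.symm
  simp only [Function.comp, Nat.pairEquiv_apply, Function.uncurry, IsTensor.pairCoords,
    Nat.unpair_pair]

/-- Ampliations are normal. -/
theorem IsTensor.continuous_amplHom :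
    @Continuous _ _ (ultraweakTopology Y) (ultraweakTopology Z) (hB.amplHom hb) := by
  refine continuous_iInf_rng.2 fun ξ => continuous_iInf_rng.2 fun η => continuous_induced_rng.2 ?_
  have h : (fun A : Z →L[ℂ] Z => ∑' n, ⟪ξ n, A (η n)⟫_ℂ) ∘ hB.amplHom hb
      = fun A => ∑' m, ⟪hB.pairCoords hb ξ m, A (hB.pairCoords hb η m)⟫_ℂ :=
    funext fun A => hB.tsum_inner_amplHom hb ξ η A
  rw [h]
  exact continuous_iInf_dom (i := hB.pairCoords hb ξ) <|
    continuous_iInf_dom (i := hB.pairCoords hb η) continuous_induced_dom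

end Ampliation

/-! ### Measurable sections -/

section Sections

variable {P : Type v} [Semigroup P] [MeasurableSpace P] {E : MulField.{u} P}

namespace IsMeasurableField

variable (hE : IsMeasurableField E)
include hE

theorem add_mem {s t : ∀ x, E.fiber x} (hs : s ∈ E.sections) (ht : t ∈ E.sections) :
    (fun x => s x + t x) ∈ E.sections := by
  refine hE.saturated _ fun r hr => ?_
  simp only [inner_add_right]
  exact (hE.inner_measurable r hr s hs).add (hE.inner_measurable r hr t ht)

theorem smul_mem {s : ∀ x, E.fiber x} (hs : s ∈ E.sections) {f : P → ℂ} (hf : Measurable f) :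
    (fun x => f x • s x) ∈ E.sections := by
  refine hE.saturated _ fun r hr => ?_
  simp only [inner_smul_right]
  exact hf.mul (hE.inner_measurable r hr s hs)

theorem zero_mem : (fun _ => 0) ∈ E.sections := by
  refine hE.saturated _ fun r hr => ?_
  simp

theorem sub_mem {s t : ∀ x, E.fiber x} (hs : s ∈ E.sections) (ht : t ∈ E.sections) :
    (fun x => s x - t x) ∈ E.sections := by
  simpa [sub_eq_add_neg] using hE.add_mem hs (hE.smul_mem ht (measurable_const (a := (-1 : ℂ))))

theorem sum_mem {ι : Type*} (I : Finset ι) {s : ι → ∀ x, E.fiber x}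
    (hs : ∀ i ∈ I, s i ∈ E.sections) : (fun x => ∑ i ∈ I, s i x) ∈ E.sections := by
  refine hE.saturated _ fun r hr => ?_
  simp only [inner_sum]
  exact Finset.measurable_sum _ fun i hi => hE.inner_measurable r hr _ (hs i hi)

theorem norm_sq_measurable {s : ∀ x, E.fiber x} (hs : s ∈ E.sections) :
    Measurable fun x => ‖s x‖ ^ 2 := by
  have h := Complex.measurable_re.comp (hE.inner_measurable s hs s hs)
  simpa [Function.comp_def, inner_self_eq_norm_sq_to_K, ← Complex.ofReal_pow] using h

theorem norm_measurable {s : ∀ x, E.fiber x} (hs : s ∈ E.sections) :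
    Measurable fun x => ‖s x‖ := by
  simpa [Real.sqrt_sq] using (hE.norm_sq_measurable hs).sqrt

/-- The Gram–Schmidt process preserves measurability. Where a squared norm in a denominator
vanishes, the quotient multiplies the zero vector. -/
theorem gramSchmidt_mem {e : ℕ → ∀ x, E.fiber x} (he : ∀ n, e n ∈ E.sections) (n : ℕ) :
    (fun x => InnerProductSpace.gramSchmidt ℂ (fun k => e k x) n) ∈ E.sections := by
  induction n using Nat.strong_induction_on with
  | _ n ih =>
    simp only [InnerProductSpace.gramSchmidt_def ℂ _ n, Submodule.starProjection_singleton]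
    refine hE.sub_mem (he n) (hE.sum_mem _ fun i hi => ?_)
    have hi' := ih i (Finset.mem_Iio.1 hi)
    refine hE.smul_mem hi' ((hE.inner_measurable _ hi' _ (he n)).div ?_)
    exact Complex.measurable_ofReal.comp (hE.norm_sq_measurable hi')

/-- A measurable field of Hilbert spaces has a measurable field of orthonormal bases. -/
theorem exists_basis : ∃ b : ℕ → ∀ x, E.fiber x, (∀ n, b n ∈ E.sections) ∧
    ∀ x, IsPaddedBasis fun n => b n x := by
  obtain ⟨e, he, het⟩ := hE.exists_total
  refine ⟨fun n x => InnerProductSpace.gramSchmidtNormed ℂ (fun k => e k x) n, fun n => ?_,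
    fun x => isPaddedBasis_gramSchmidtNormed (het x)⟩
  have h := hE.gramSchmidt_mem he n
  exact hE.smul_mem h (Complex.measurable_ofReal.comp (hE.norm_measurable h)).inv

end IsMeasurableField

end Sections

/-! ### Representations of product systems -/

section Rep

variable {P : Type v} [Semigroup P] [MeasurableSpace P] {E : MulField.{u} P}

/-- A (measurable) representation of the product system `E` on a possibly incomplete inner product
space: for unit vectors `u`, `v` the operators are isometries whose ranges make the angle of `u`
and `v`. -/
structure Rep (E : MulField.{u} P) (V : Type w) [SeminormedAddCommGroup V]
    [InnerProductSpace ℂ V] where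
  /-- the operator of a vector of the fibre over `x` -/
  op : ∀ x, E.fiber x →ₗ[ℂ] V →ₗ[ℂ] V
  inner_op : ∀ x u v f g, ⟪op x u f, op x v g⟫_ℂ = ⟪u, v⟫_ℂ * ⟪f, g⟫_ℂ
  op_mul : ∀ x y (u : E.fiber x) (v : E.fiber y) f, op (x * y) (E.mul u v) f = op x u (op y v f)
  measurable : ∀ s ∈ E.sections, ∀ f g, Measurable fun x => ⟪g, op x (s x) f⟫_ℂ

/-- A representation is nondegenerate if the operators of each fibre have total range. -/
def Rep.IsNondegenerate {V : Type w} [SeminormedAddCommGroup V] [InnerProductSpace ℂ V]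
    (R : Rep E V) : Prop :=
  ∀ x, Dense (Submodule.span ℂ (Set.range fun p : E.fiber x × V => R.op x p.1 p.2) : Set V)

theorem Rep.norm_op {V : Type w} [SeminormedAddCommGroup V] [InnerProductSpace ℂ V]
    (R : Rep E V) (x : P) (u : E.fiber x) (f : V) : ‖R.op x u f‖ = ‖u‖ * ‖f‖ := by
  have h := R.inner_op x u u f f
  simp only [inner_self_eq_norm_sq_to_K] at h
  have h' : ‖R.op x u f‖ ^ 2 = (‖u‖ * ‖f‖) ^ 2 := by rw [mul_pow]; exact_mod_cast h
  exact (sq_eq_sq₀ (norm_nonneg _) (by positivity)).1 h'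

variable {H : Type w} [NormedAddCommGroup H] [InnerProductSpace ℂ H]

/-- The operators of a representation as bounded operators. -/
def Rep.opL (R : Rep E H) (x : P) : E.fiber x →ₗ[ℂ] H →L[ℂ] H where
  toFun u := (R.op x u).mkContinuous ‖u‖ fun f => (R.norm_op x u f).le
  map_add' u v := by ext; simp
  map_smul' c u := by ext; simp

@[simp]
theorem Rep.opL_apply (R : Rep E H) (x : P) (u : E.fiber x) (f : H) :
    R.opL x u f = R.op x u f := rfl

theorem Rep.isTensor {R : Rep E H} (hR : R.IsNondegenerate) (x : P) : IsTensor (R.opL x) where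
  inner_eq := R.inner_op x
  dense := Submodule.dense_iff_topologicalClosure_eq_top.1 (hR x)

end Rep

/-! ### From a representation to an `E₀`-semigroup -/

section Concrete

variable {P : Type v} [Semigroup P] [MeasurableSpace P] {E : MulField.{u} P}
  {H : Type w} [NormedAddCommGroup H] [InnerProductSpace ℂ H] [CompleteSpace H]

/-- The coefficients of `A ↦ 1 ⊗ A` depend measurably on the base point. Expanding along an
orthonormal basis of `H` reduces this to the weak measurability of the representation. -/
theorem Rep.measurable_inner_ampl [TopologicalSpace.SeparableSpace H] {R : Rep E H}
    (hR : R.IsNondegenerate) {b : ℕ → ∀ x, E.fiber x}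
    (hb : ∀ n, b n ∈ E.sections) (hbx : ∀ x, IsPaddedBasis fun n => b n x)
    (A : H →L[ℂ] H) (ξ η : H) :
    Measurable fun x => ⟪η, (R.isTensor hR x).amplHom (hbx x) A ξ⟫_ℂ := by
  have hd : IsPaddedBasis
      (InnerProductSpace.gramSchmidtNormed ℂ (TopologicalSpace.denseSeq H)) := by
    refine isPaddedBasis_gramSchmidtNormed (Submodule.dense_iff_topologicalClosure_eq_top.1 ?_)
    exact (TopologicalSpace.denseRange_denseSeq H).mono Submodule.subset_span
  set d := InnerProductSpace.gramSchmidtNormed ℂ (TopologicalSpace.denseSeq H)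
  have hterm : ∀ n, Measurable fun x => ⟪ContinuousLinearMap.adjoint (R.opL x (b n x)) η,
      A (ContinuousLinearMap.adjoint (R.opL x (b n x)) ξ)⟫_ℂ := by
    intro n
    have hk : ∀ k, Measurable fun x =>
        ⟪η, R.op x (b n x) (A (d k))⟫_ℂ * (starRingEnd ℂ) ⟪ξ, R.op x (b n x) (d k)⟫_ℂ := fun k =>
      (R.measurable _ (hb n) _ _).mul
        (Complex.continuous_conj.measurable.comp (R.measurable _ (hb n) _ _))
    refine measurable_of_tendsto_metrizable
      (fun N => Finset.measurable_sum (Finset.range N) fun k _ => hk k) ?_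
    refine tendsto_pi_nhds.2 fun x => ?_
    have h := (hd.hasSum_inner
      (ContinuousLinearMap.adjoint A (ContinuousLinearMap.adjoint (R.opL x (b n x)) η))
      (ContinuousLinearMap.adjoint (R.opL x (b n x)) ξ)).tendsto_sum_nat
    rw [ContinuousLinearMap.adjoint_inner_left] at h
    simpa only [ContinuousLinearMap.adjoint_inner_left, ContinuousLinearMap.adjoint_inner_right,
      inner_conj_symm, Rep.opL_apply] using h
  refine measurable_of_tendsto_metrizable
    (fun N => Finset.measurable_sum (Finset.range N) fun n _ => hterm n) ?_
  refine tendsto_pi_nhds.2 fun x => ?_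
  exact ((R.isTensor hR x).hasSum_inner_ampl (hbx x) A η ξ).tendsto_sum_nat

/-- The `E₀`-semigroup `A ↦ ∑ₙ φ(bₙ(x)) A φ(bₙ(x))*` of a nondegenerate representation `φ`. -/
def Rep.e0Semigroup [TopologicalSpace.SeparableSpace H] {R : Rep E H}
    (hR : R.IsNondegenerate) {b : ℕ → ∀ x, E.fiber x}
    (hb : ∀ n, b n ∈ E.sections) (hbx : ∀ x, IsPaddedBasis fun n => b n x) :
    E0Semigroup P H where
  toHom x := (R.isTensor hR x).amplHom (hbx x)
  normal x := (R.isTensor hR x).continuous_amplHom (hbx x)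
  map_mul x y A := by
    refine (R.isTensor hR x).clm_ext fun u f => ?_
    rw [IsTensor.amplHom_apply]
    -- compare `α_{xy}(A)` and `α_x(α_y(A))` on the vectors `φ(u) φ(v) g = φ(uv) g`
    refine congrArg (fun T : H →L[ℂ] H => T f) ((R.isTensor hR y).clm_ext
      (S := (R.isTensor hR (x * y)).amplHom (hbx (x * y)) A ∘L R.opL x u)
      (T := R.opL x u ∘L (R.isTensor hR y).amplHom (hbx y) A) fun v g => ?_)
    simp only [ContinuousLinearMap.comp_apply, IsTensor.amplHom_apply]
    have h : ∀ g, R.opL x u (R.opL y v g) = R.opL (x * y) (E.mul u v) g :=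
      fun g => (R.op_mul x y u v g).symm
    rw [h, h, IsTensor.amplHom_apply]
  measurable A ξ η := R.measurable_inner_ampl hR hb hbx A ξ η

/-- The intertwiners of `A ↦ 1 ⊗ A` are the operators of the left factor: for an
intertwiner `T`, the operators `B u* T` are scalars, which determine `T`. -/
theorem IsTensor.exists_eq_of_mem_intertwiners [Nontrivial H] {X : Type*} [NormedAddCommGroup X]
    [InnerProductSpace ℂ X] [CompleteSpace X] {B : X →ₗ[ℂ] H →L[ℂ] H} (hB : IsTensor B)
    {b : ℕ → X} (hb : IsPaddedBasis b) (T : intertwiners (hB.amplHom hb)) :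
    ∃ u : X, B u = T := by
  have hmem : ∀ u : X, B u ∈ intertwiners (hB.amplHom hb) := fun u A =>
    ContinuousLinearMap.ext fun f => hB.amplHom_apply hb A u f
  have hnorm : ∀ u : X, ‖B u (unitVector H)‖ = ‖u‖ := fun u => by
    rw [hB.norm_apply, norm_unitVector, mul_one]
  let Φ : X →ₗᵢ[ℂ] H :=
    { toFun := fun u => B u (unitVector H)
      map_add' := fun u v => by simp
      map_smul' := fun c u => by simp
      norm_map' := hnorm }
  have hinner : ∀ (u : X) (ξ : H), ContinuousLinearMap.adjoint (B u) ((T : H →L[ℂ] H) ξ)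
      = ⟪Φ u, (T : H →L[ℂ] H) (unitVector H)⟫_ℂ • ξ := fun u ξ =>
    adjoint_mul_apply _ (⟨B u, hmem u⟩ : intertwiners (hB.amplHom hb)) T ξ
  -- the vector `w` representing `T` is the contraction of `T` at a unit vector
  let w := ContinuousLinearMap.adjoint Φ.toContinuousLinearMap ((T : H →L[ℂ] H) (unitVector H))
  refine ⟨w, ContinuousLinearMap.ext fun ξ => hB.eq_of_adjoint_eq fun u f => ?_⟩
  rw [hB.inner_eq, ← ContinuousLinearMap.adjoint_inner_right, hinner, inner_smul_right]
  congr 1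
  exact ContinuousLinearMap.adjoint_inner_right _ _ _

/-- A product system with a nondegenerate representation on a separable Hilbert space is
concrete. -/
theorem Rep.isConcrete {H : Type} [NormedAddCommGroup H] [InnerProductSpace ℂ H] [CompleteSpace H]
    [TopologicalSpace.SeparableSpace H] [Nontrivial H] {R : Rep E H} (hR : R.IsNondegenerate)
    (hE : IsProductSystem E) : IsConcrete E := by
  obtain ⟨b, hb, hbx⟩ := hE.field.exists_basis
  refine ⟨H, inferInstance, inferInstance, inferInstance, inferInstance, inferInstance,
    R.e0Semigroup hR hb hbx, ?_⟩
  have hmem : ∀ x (u : E.fiber x),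
      R.opL x u ∈ intertwiners ((R.isTensor hR x).amplHom (hbx x)) := fun x u A =>
    ContinuousLinearMap.ext fun f => (R.isTensor hR x).amplHom_apply (hbx x) A u f
  let Φ : ∀ x, E.fiber x →ₗᵢ[ℂ] intertwiners ((R.isTensor hR x).amplHom (hbx x)) := fun x =>
    { toFun := fun u => ⟨R.opL x u, hmem x u⟩
      map_add' := fun u v => Subtype.ext (map_add _ _ _)
      map_smul' := fun c u => Subtype.ext (map_smul _ _ _)
      norm_map' := fun u => by
        rw [norm_intertwiner_apply]
        change ‖R.opL x u (unitVector H)‖ = _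
        rw [(R.isTensor hR x).norm_apply, norm_unitVector, mul_one] }
  have hsurj : ∀ x, Function.Surjective (Φ x) := fun x T => by
    have := hE.algebraic.complete x
    obtain ⟨u, hu⟩ := (R.isTensor hR x).exists_eq_of_mem_intertwiners (hbx x) T
    exact ⟨u, Subtype.ext hu⟩
  refine ⟨fun x => LinearIsometryEquiv.ofSurjective (Φ x) (hsurj x), fun x y p q => ?_,
    fun s hs ξ η => R.measurable s hs ξ η⟩
  exact Subtype.ext (ContinuousLinearMap.ext fun f => R.op_mul x y p q f)

end Concrete

/-! ### Completion of a representation -/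

section Completion

/-- Every separable inner product space embeds densely into a separable Hilbert space that lives in
the lowest universe, namely the closure of its image in `ℓ²`. -/
theorem exists_dense_isometry (V : Type w) [SeminormedAddCommGroup V] [InnerProductSpace ℂ V]
    [TopologicalSpace.SeparableSpace V] :
    ∃ (H : Type) (_ : NormedAddCommGroup H) (_ : InnerProductSpace ℂ H) (_ : CompleteSpace H)
      (_ : TopologicalSpace.SeparableSpace H) (κ : V →ₗᵢ[ℂ] H), DenseRange κ := by
  have hd : IsPaddedBasis (InnerProductSpace.gramSchmidtNormed ℂ
      (TopologicalSpace.denseSeq (Completion V))) := by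
    refine isPaddedBasis_gramSchmidtNormed (Submodule.dense_iff_topologicalClosure_eq_top.1 ?_)
    exact (TopologicalSpace.denseRange_denseSeq _).mono Submodule.subset_span
  let Φ : Completion V →L[ℂ] lp (fun _ : ℕ => ℂ) 2 := isTensor_smulRight.coords hd
  have hΦ : ∀ z z', ⟪Φ z, Φ z'⟫_ℂ = ⟪z, z'⟫_ℂ := fun z z' => by
    rw [lp.inner_eq_tsum]
    exact (isTensor_smulRight.hasSum_inner hd z z').tsum_eq
  let Ψ : V →ₗ[ℂ] lp (fun _ : ℕ => ℂ) 2 :=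
    Φ.toLinearMap ∘ₗ (Completion.toComplₗᵢ (𝕜 := ℂ) (E := V)).toLinearMap
  have hΨ : ∀ z z', ⟪Ψ z, Ψ z'⟫_ℂ = ⟪z, z'⟫_ℂ := fun z z' =>
    (hΦ _ _).trans (Completion.inner_coe z z')
  let K := (LinearMap.range Ψ).topologicalClosure
  have hK : ∀ f, Ψ f ∈ K := fun f =>
    Submodule.le_topologicalClosure _ (LinearMap.mem_range_self Ψ f)
  let κ : V →ₗᵢ[ℂ] K := (Ψ.codRestrict K hK).isometryOfInner fun f g => hΨ f g
  have hκ : DenseRange κ := by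
    intro z
    have hz : (z : lp (fun _ : ℕ => ℂ) 2) ∈ closure (LinearMap.range Ψ : Set _) := z.2
    rw [closure_subtype]
    convert hz using 1
    congr 1
    ext y
    simp only [Set.mem_image, Set.mem_range, SetLike.mem_coe, LinearMap.mem_range]
    constructor
    · rintro ⟨_, ⟨f, rfl⟩, rfl⟩
      exact ⟨f, rfl⟩
    · rintro ⟨f, rfl⟩
      exact ⟨_, ⟨f, rfl⟩, rfl⟩
  have hcomplete : CompleteSpace K :=
    (Submodule.isClosed_topologicalClosure (LinearMap.range Ψ)).completeSpace_coe
  exact ⟨K, inferInstance, inferInstance, hcomplete,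
    hκ.separableSpace κ.continuous, κ, hκ⟩

variable {P : Type v} [Semigroup P] [MeasurableSpace P] {E : MulField.{u} P}
  {V : Type w} [SeminormedAddCommGroup V] [InnerProductSpace ℂ V]
  {H : Type*} [NormedAddCommGroup H] [InnerProductSpace ℂ H] [CompleteSpace H]

/-- The continuous extension of an operator of a representation along a dense isometry. -/
def Rep.extendOp (R : Rep E V) (κ : V →ₗᵢ[ℂ] H) (x : P) (u : E.fiber x) : H →L[ℂ] H :=
  (κ.toLinearMap ∘ₗ R.op x u).extendOfNorm κ.toLinearMap

theorem Rep.extendOp_apply (R : Rep E V) {κ : V →ₗᵢ[ℂ] H} (hκ : DenseRange κ) (x : P)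
    (u : E.fiber x) (f : V) : R.extendOp κ x u (κ f) = κ (R.op x u f) := by
  refine LinearMap.extendOfNorm_eq (e := κ.toLinearMap) hκ ⟨‖u‖, fun f => ?_⟩ f
  simp [R.norm_op]

/-- The extension of a representation to a completion. -/
def Rep.extend (R : Rep E V) {κ : V →ₗᵢ[ℂ] H} (hκ : DenseRange κ) : Rep E H where
  op x :=
    { toFun := fun u => R.extendOp κ x u
      map_add' := fun u v => by
        refine LinearMap.ext fun f => hκ.induction_on f ?_ fun f => ?_
        · exact isClosed_eq (R.extendOp κ x (u + v)).continuous
            ((R.extendOp κ x u).continuous.add (R.extendOp κ x v).continuous)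
        · simp [R.extendOp_apply hκ]
      map_smul' := fun c u => by
        refine LinearMap.ext fun f => hκ.induction_on f ?_ fun f => ?_
        · exact isClosed_eq (R.extendOp κ x (c • u)).continuous
            ((R.extendOp κ x u).continuous.const_smul c)
        · simp [R.extendOp_apply hκ] }
  inner_op x u v f g := by
    refine hκ.induction_on₂ (p := fun f g =>
      ⟪R.extendOp κ x u f, R.extendOp κ x v g⟫_ℂ = ⟪u, v⟫_ℂ * ⟪f, g⟫_ℂ) ?_ ?_ f g
    · exact isClosed_eq (by fun_prop) (by fun_prop)
    · intro f g
      rw [R.extendOp_apply hκ, R.extendOp_apply hκ, κ.inner_map_map, κ.inner_map_map, R.inner_op]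
  op_mul x y u v f := by
    refine hκ.induction_on (p := fun f =>
      R.extendOp κ (x * y) (E.mul u v) f = R.extendOp κ x u (R.extendOp κ y v f)) f ?_ ?_
    · exact isClosed_eq (by fun_prop) (by fun_prop)
    · intro f
      rw [R.extendOp_apply hκ, R.extendOp_apply hκ, R.extendOp_apply hκ, R.op_mul]
  measurable s hs f g := by
    obtain ⟨f', hf', hf⟩ := mem_closure_iff_seq_limit.1 (hκ f)
    obtain ⟨g', hg', hg⟩ := mem_closure_iff_seq_limit.1 (hκ g)
    refine measurable_of_tendsto_metrizable
      (f := fun n x => ⟪g' n, R.extendOp κ x (s x) (f' n)⟫_ℂ) (fun n => ?_) ?_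
    · obtain ⟨f₀, hf₀⟩ := hf' n
      obtain ⟨g₀, hg₀⟩ := hg' n
      simp only [← hf₀, ← hg₀, R.extendOp_apply hκ, κ.inner_map_map]
      exact R.measurable s hs f₀ g₀
    · exact tendsto_pi_nhds.2 fun x =>
        hg.inner (((R.extendOp κ x (s x)).continuous.tendsto f).comp hf)

theorem Rep.extend_op_apply (R : Rep E V) {κ : V →ₗᵢ[ℂ] H} (hκ : DenseRange κ) (x : P)
    (u : E.fiber x) (f : V) : (R.extend hκ).op x u (κ f) = κ (R.op x u f) :=
  R.extendOp_apply hκ x u f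

theorem Rep.extend_isNondegenerate {R : Rep E V} (hR : R.IsNondegenerate) {κ : V →ₗᵢ[ℂ] H}
    (hκ : DenseRange κ) : (R.extend hκ).IsNondegenerate := by
  intro x
  have h := hκ.dense_image κ.continuous (hR x)
  refine h.mono ?_
  rintro _ ⟨f, hf, rfl⟩
  induction hf using Submodule.span_induction with
  | mem f hf =>
    obtain ⟨⟨u, g⟩, rfl⟩ := hf
    exact Submodule.subset_span ⟨(u, κ g), R.extend_op_apply hκ x u g⟩
  | zero => simp
  | add f g _ _ hf hg => rw [map_add]; exact add_mem hf hg
  | smul c f _ hf => rw [map_smul]; exact Submodule.smul_mem _ c hf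

/-- A product system with a nondegenerate representation on a separable, possibly incomplete, inner
product space is concrete. -/
theorem Rep.isConcrete_of_separable [TopologicalSpace.SeparableSpace V] {R : Rep E V}
    (hR : R.IsNondegenerate) (hV : ∃ f : V, ‖f‖ ≠ 0) (hE : IsProductSystem E) :
    IsConcrete E := by
  obtain ⟨H, _, _, _, _, κ, hκ⟩ := exists_dense_isometry V
  obtain ⟨f, hf⟩ := hV
  have : Nontrivial H := ⟨κ f, 0, fun h => hf (by rw [← κ.norm_map, h, norm_zero])⟩
  exact (R.extend hκ).isConcrete (Rep.extend_isNondegenerate hR hκ) hE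

end Completion

/-! ### The direct limit along an isometry -/

section DirLim

variable {V : Type w} [SeminormedAddCommGroup V] [InnerProductSpace ℂ V]

/-- The space of sequences in `V` that are eventually orbits of the isometry `J`. -/
def orbitSeqs (J : V →ₗᵢ[ℂ] V) : Submodule ℂ (ℕ → V) where
  carrier := {f | ∃ N, ∀ n ≥ N, f (n + 1) = J (f n)}
  add_mem' := by
    rintro f g ⟨N, hN⟩ ⟨M, hM⟩
    refine ⟨max N M, fun n hn => ?_⟩
    simp [hN n (le_of_max_le_left hn), hM n (le_of_max_le_right hn)]
  zero_mem' := ⟨0, fun n _ => by simp⟩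
  smul_mem' := by
    rintro c f ⟨N, hN⟩
    exact ⟨N, fun n hn => by simp [hN n hn]⟩

/-- The direct limit of `V → V → ⋯` along an isometry `J`, realised as the space of sequences that
are eventually orbits of `J`; sequences that agree eventually are identified only by the seminorm.
This is a type synonym because the product topology on sequences is not the one that is used. -/
def DirLim (J : V →ₗᵢ[ℂ] V) : Type w := orbitSeqs J

namespace DirLim

variable {J : V →ₗᵢ[ℂ] V}

instance : AddCommGroup (DirLim J) := inferInstanceAs (AddCommGroup (orbitSeqs J))

instance : Module ℂ (DirLim J) := inferInstanceAs (Module ℂ (orbitSeqs J))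

/-- The underlying sequence of an element of the direct limit. -/
def seq : DirLim J →ₗ[ℂ] (ℕ → V) := (orbitSeqs J).subtype

theorem exists_stable (f : DirLim J) : ∃ N, ∀ n ≥ N, seq f (n + 1) = J (seq f n) := f.2

theorem exists_stable₂ (f g : DirLim J) : ∃ N, (∀ n ≥ N, seq f (n + 1) = J (seq f n)) ∧
    ∀ n ≥ N, seq g (n + 1) = J (seq g n) := by
  obtain ⟨N, hN⟩ := f.exists_stable
  obtain ⟨M, hM⟩ := g.exists_stable
  exact ⟨max N M, fun n hn => hN n (le_of_max_le_left hn), fun n hn => hM n (le_of_max_le_right hn)⟩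

/-- The inner product of two sequences, which is eventually constant along them. -/
def innerAux (f g : DirLim J) : ℂ := limUnder atTop fun n => ⟪seq f n, seq g n⟫_ℂ

theorem innerAux_eq {f g : DirLim J} {N : ℕ} (hf : ∀ n ≥ N, seq f (n + 1) = J (seq f n))
    (hg : ∀ n ≥ N, seq g (n + 1) = J (seq g n)) {n : ℕ} (hn : N ≤ n) :
    innerAux f g = ⟪seq f n, seq g n⟫_ℂ := by
  refine Tendsto.limUnder_eq (tendsto_const_nhds.congr' ?_)
  filter_upwards [eventually_ge_atTop n] with m hm
  induction m, hm using Nat.le_induction with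
  | base => rfl
  | succ m hm ih =>
    rw [hf m (hn.trans hm), hg m (hn.trans hm), J.inner_map_map, ih]

theorem exists_innerAux_eq (f g : DirLim J) :
    ∃ N, ∀ n ≥ N, innerAux f g = ⟪seq f n, seq g n⟫_ℂ := by
  obtain ⟨N, hf, hg⟩ := exists_stable₂ f g
  exact ⟨N, fun n hn => innerAux_eq hf hg hn⟩

/-- The semi-inner product of the direct limit. -/
@[reducible]
def innerCore (J : V →ₗᵢ[ℂ] V) : PreInnerProductSpace.Core ℂ (DirLim J) where
  inner := innerAux
  conj_inner_symm f g := by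
    obtain ⟨N, h⟩ := exists_innerAux_eq f g
    obtain ⟨M, h'⟩ := exists_innerAux_eq g f
    rw [h _ (le_max_left N M), h' _ (le_max_right N M), inner_conj_symm]
  re_inner_nonneg f := by
    obtain ⟨N, h⟩ := exists_innerAux_eq f f
    rw [h _ le_rfl]
    exact inner_self_nonneg
  add_left f f' g := by
    obtain ⟨N, h⟩ := exists_innerAux_eq f g
    obtain ⟨M, h'⟩ := exists_innerAux_eq f' g
    obtain ⟨K, hK⟩ := exists_innerAux_eq (f + f') g
    rw [h (N + M + K) (by omega), h' (N + M + K) (by omega), hK (N + M + K) (by omega), map_add,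
      Pi.add_apply, inner_add_left]
  smul_left f g c := by
    obtain ⟨N, h⟩ := exists_innerAux_eq f g
    obtain ⟨K, hK⟩ := exists_innerAux_eq (c • f) g
    rw [h (N + K) (by omega), hK (N + K) (by omega), map_smul, Pi.smul_apply, inner_smul_left]

instance : SeminormedAddCommGroup (DirLim J) :=
  @InnerProductSpace.Core.toSeminormedAddCommGroup ℂ _ _ _ _ (innerCore J)

instance : InnerProductSpace ℂ (DirLim J) := InnerProductSpace.ofCore (innerCore J)

theorem inner_eq {f g : DirLim J} {N : ℕ} (hf : ∀ n ≥ N, seq f (n + 1) = J (seq f n))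
    (hg : ∀ n ≥ N, seq g (n + 1) = J (seq g n)) {n : ℕ} (hn : N ≤ n) :
    ⟪f, g⟫_ℂ = ⟪seq f n, seq g n⟫_ℂ := innerAux_eq hf hg hn

theorem norm_eq {f : DirLim J} {N : ℕ} (hf : ∀ n ≥ N, seq f (n + 1) = J (seq f n))
    {n : ℕ} (hn : N ≤ n) : ‖f‖ = ‖seq f n‖ := by
  rw [norm_eq_sqrt_re_inner (𝕜 := ℂ), inner_eq hf hf hn, ← norm_eq_sqrt_re_inner]

/-- The canonical isometry of the `n`-th copy of `V` into the direct limit. -/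
def of (n : ℕ) : V →ₗ[ℂ] DirLim J where
  toFun f := ⟨fun m => (J.toLinearMap ^ (m - n)) f, n, fun m hm => by
    beta_reduce
    rw [Nat.sub_add_comm hm, pow_succ']
    rfl⟩
  map_add' f g := Subtype.ext (funext fun m => map_add _ f g)
  map_smul' c f := Subtype.ext (funext fun m => map_smul _ c f)

theorem seq_of (n m : ℕ) (f : V) : seq (of n f : DirLim J) m = (J.toLinearMap ^ (m - n)) f := rfl

theorem seq_of_self (n : ℕ) (f : V) : seq (of n f : DirLim J) n = f := by simp [seq_of]

theorem seq_of_succ {n m : ℕ} (hm : m ≥ n) (f : V) :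
    seq (of n f : DirLim J) (m + 1) = J (seq (of n f : DirLim J) m) := by
  rw [seq_of, seq_of, Nat.sub_add_comm hm, pow_succ']
  rfl

/-- Distances in the direct limit are computed at any level beyond which the sequence is an
orbit. -/
theorem norm_sub_of {f : DirLim J} {N : ℕ} (hf : ∀ n ≥ N, seq f (n + 1) = J (seq f n))
    {n : ℕ} (hn : N ≤ n) (g : V) : ‖f - of n g‖ = ‖seq f n - g‖ := by
  have h : ∀ m ≥ n, seq (f - of n g) (m + 1) = J (seq (f - of n g) m) := by
    intro m hm
    simp only [map_sub, Pi.sub_apply, seq_of_succ hm, hf m (hn.trans hm)]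
  rw [norm_eq h le_rfl, map_sub, Pi.sub_apply, seq_of_self]

theorem norm_of (n : ℕ) (g : V) : ‖(of n g : DirLim J)‖ = ‖g‖ := by
  rw [norm_eq (fun m hm => seq_of_succ hm g) le_rfl, seq_of_self]

theorem continuous_of (n : ℕ) : Continuous (of n : V →ₗ[ℂ] DirLim J) :=
  ({ of n with norm_map' := norm_of n } : V →ₗᵢ[ℂ] DirLim J).continuous

instance [TopologicalSpace.SeparableSpace V] : TopologicalSpace.SeparableSpace (DirLim J) := by
  rw [← TopologicalSpace.isSeparable_univ_iff]
  have h : TopologicalSpace.IsSeparable (⋃ n, Set.range (of n : V →ₗ[ℂ] DirLim J)) :=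
    .iUnion fun n => TopologicalSpace.isSeparable_range (continuous_of n)
  refine h.closure.mono fun f _ => Metric.mem_closure_iff.2 fun ε hε => ?_
  obtain ⟨N, hN⟩ := f.exists_stable
  refine ⟨of N (seq f N), Set.mem_iUnion.2 ⟨N, _, rfl⟩, ?_⟩
  rw [dist_eq_norm, norm_sub_of hN le_rfl, sub_self, norm_zero]
  exact hε

/-- The operator on the direct limit induced by an operator that commutes with `J`. -/
def map (T : V →ₗ[ℂ] V) (hT : ∀ f, T (J f) = J (T f)) : DirLim J →ₗ[ℂ] DirLim J where
  toFun f := ⟨fun n => T (seq f n), f.exists_stable.imp fun N hN n hn => by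
    beta_reduce
    rw [hN n hn, hT]⟩
  map_add' f g := Subtype.ext (funext fun n => by simp; rfl)
  map_smul' c f := Subtype.ext (funext fun n => by simp; rfl)

theorem seq_map (T : V →ₗ[ℂ] V) (hT : ∀ f, T (J f) = J (T f)) (f : DirLim J) (n : ℕ) :
    seq (map T hT f) n = T (seq f n) := rfl

theorem ext_seq {f g : DirLim J} (h : ∀ n, seq f n = seq g n) : f = g := Subtype.ext (funext h)

theorem map_of (T : V →ₗ[ℂ] V) (hT : ∀ f, T (J f) = J (T f)) (n : ℕ) (f : V) :
    map T hT (of n f : DirLim J) = of n (T f) := by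
  refine ext_seq fun m => ?_
  rw [seq_map, seq_of, seq_of]
  induction m - n with
  | zero => rfl
  | succ k ih =>
    rw [pow_succ']
    exact (hT _).trans (congrArg J ih)

end DirLim

variable {P : Type v} [Semigroup P] [MeasurableSpace P] {E : MulField.{u} P} {J : V →ₗᵢ[ℂ] V}

/-- The representation on the direct limit induced by a representation that commutes with `J`. -/
def Rep.dirLim (R : Rep E V) (hJ : ∀ x u f, R.op x u (J f) = J (R.op x u f)) :
    Rep E (DirLim J) where
  op x :=
    { toFun := fun u => DirLim.map (R.op x u) (hJ x u)
      map_add' := fun u v => LinearMap.ext fun f => DirLim.ext_seq fun n => by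
        simp [DirLim.seq_map]
      map_smul' := fun c u => LinearMap.ext fun f => DirLim.ext_seq fun n => by
        simp [DirLim.seq_map] }
  inner_op x u v f g := by
    obtain ⟨N, hf, hg⟩ := DirLim.exists_stable₂ f g
    change ⟪DirLim.map (R.op x u) (hJ x u) f, DirLim.map (R.op x v) (hJ x v) g⟫_ℂ = _
    rw [DirLim.inner_eq (N := N) (n := N) _ _ le_rfl, DirLim.inner_eq hf hg le_rfl,
      DirLim.seq_map, DirLim.seq_map, R.inner_op]
    · intro n hn
      rw [DirLim.seq_map, DirLim.seq_map, hf n hn, hJ]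
    · intro n hn
      rw [DirLim.seq_map, DirLim.seq_map, hg n hn, hJ]
  op_mul x y u v f := DirLim.ext_seq fun n => R.op_mul x y u v (DirLim.seq f n)
  measurable s hs f g := by
    -- the level at which the inner products are computed does not depend on the base point
    obtain ⟨N, hf, hg⟩ := DirLim.exists_stable₂ f g
    have h : ∀ x, ⟪g, DirLim.map (R.op x (s x)) (hJ x (s x)) f⟫_ℂ
        = ⟪DirLim.seq g N, R.op x (s x) (DirLim.seq f N)⟫_ℂ := fun x => by
      rw [DirLim.inner_eq hg (fun n hn => ?_) le_rfl, DirLim.seq_map]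
      rw [DirLim.seq_map, DirLim.seq_map, hf n hn, hJ]
    exact (funext h ▸ R.measurable s hs _ _ :)

/-- If, under iteration of `J`, every vector gets arbitrarily close to the span of the ranges of
the operators of each fibre, then the induced representation on the direct limit is
nondegenerate. -/
theorem Rep.dirLim_isNondegenerate {R : Rep E V}
    (hJ : ∀ x u f, R.op x u (J f) = J (R.op x u f))
    (h : ∀ (x : P) (f : V), ∀ ε > 0, ∃ n, ∃ g ∈ Submodule.span ℂ
      (Set.range fun p : E.fiber x × V => R.op x p.1 p.2), ‖(J.toLinearMap ^ n) f - g‖ < ε) :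
    (R.dirLim hJ).IsNondegenerate := by
  intro x f
  refine Metric.mem_closure_iff.2 fun ε hε => ?_
  obtain ⟨N, hN⟩ := f.exists_stable
  obtain ⟨n, g, hg, hlt⟩ := h x (DirLim.seq f N) ε hε
  have hseq : ∀ k, DirLim.seq f (N + k) = (J.toLinearMap ^ k) (DirLim.seq f N) := by
    intro k
    induction k with
    | zero => rfl
    | succ k ih => rw [← add_assoc, hN _ (by omega), ih, pow_succ']; rfl
  refine ⟨DirLim.of (N + n) g, ?_, ?_⟩
  · clear hlt
    induction hg using Submodule.span_induction with
    | mem g hg =>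
      obtain ⟨⟨u, k⟩, rfl⟩ := hg
      exact Submodule.subset_span
        ⟨(u, DirLim.of (N + n) k), DirLim.map_of (R.op x u) (hJ x u) (N + n) k⟩
    | zero => simp
    | add f g _ _ hf hg => rw [map_add]; exact add_mem hf hg
    | smul c f _ hf => rw [map_smul]; exact Submodule.smul_mem _ c hf
  · rwa [dist_eq_norm, DirLim.norm_sub_of hN (by omega), hseq]

end DirLim

/-! ### Multiplication in a product system -/

section Multiplication

variable {P : Type v} [Semigroup P] {E : MulField.{u} P}

namespace IsAlgebraicProductSystem

variable (hE : IsAlgebraicProductSystem E) {x y : P}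
include hE

theorem add_mul (p p' : E.fiber x) (q : E.fiber y) :
    E.mul (p + p') q = E.mul p q + E.mul p' q := by
  obtain ⟨U, hU⟩ := hE.unitary x y
  rw [← hU, ← hU, ← hU, TensorProduct.add_tmul, Completion.coe_add, map_add]

theorem mul_add (p : E.fiber x) (q q' : E.fiber y) :
    E.mul p (q + q') = E.mul p q + E.mul p q' := by
  obtain ⟨U, hU⟩ := hE.unitary x y
  rw [← hU, ← hU, ← hU, TensorProduct.tmul_add, Completion.coe_add, map_add]

theorem smul_mul (c : ℂ) (p : E.fiber x) (q : E.fiber y) :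
    E.mul (c • p) q = c • E.mul p q := by
  obtain ⟨U, hU⟩ := hE.unitary x y
  rw [← hU, ← hU, ← TensorProduct.smul_tmul', Completion.coe_smul, map_smul]

theorem mul_smul (c : ℂ) (p : E.fiber x) (q : E.fiber y) :
    E.mul p (c • q) = c • E.mul p q := by
  obtain ⟨U, hU⟩ := hE.unitary x y
  rw [← hU, ← hU, TensorProduct.tmul_smul, Completion.coe_smul, map_smul]

theorem norm_mul (p : E.fiber x) (q : E.fiber y) : ‖E.mul p q‖ = ‖p‖ * ‖q‖ := by
  obtain ⟨U, hU⟩ := hE.unitary x y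
  rw [← hU, U.norm_map, Completion.norm_coe, TensorProduct.norm_tmul]

theorem inner_mul (p p' : E.fiber x) (q q' : E.fiber y) :
    ⟪E.mul p q, E.mul p' q'⟫_ℂ = ⟪p, p'⟫_ℂ * ⟪q, q'⟫_ℂ := by
  obtain ⟨U, hU⟩ := hE.unitary x y
  rw [← hU, ← hU, U.inner_map_map, Completion.inner_coe, TensorProduct.inner_tmul]

end IsAlgebraicProductSystem

/-- The multiplication `E(x) × E(y) → E(xy)` as a bilinear map. -/
def mulL (hE : IsAlgebraicProductSystem E) (x y : P) :
    E.fiber x →ₗ[ℂ] E.fiber y →L[ℂ] E.fiber (x * y) where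
  toFun p := LinearMap.mkContinuous
    { toFun := fun q => E.mul p q
      map_add' := hE.mul_add p
      map_smul' := fun c => hE.mul_smul c p }
    ‖p‖ fun q => (hE.norm_mul p q).le
  map_add' p p' := ContinuousLinearMap.ext fun q => hE.add_mul p p' q
  map_smul' c p := ContinuousLinearMap.ext fun q => hE.smul_mul c p q

theorem isTensor_mulL (hE : IsAlgebraicProductSystem E) (x y : P) : IsTensor (mulL hE x y) where
  inner_eq := hE.inner_mul
  dense := by
    obtain ⟨U, hU⟩ := hE.unitary x y
    rw [← Submodule.dense_iff_topologicalClosure_eq_top]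
    have h1 : DenseRange fun t : E.fiber x ⊗[ℂ] E.fiber y => U (t : Completion _) :=
      U.surjective.denseRange.comp Completion.denseRange_coe U.continuous
    refine h1.mono ?_
    rintro _ ⟨t, rfl⟩
    induction t using TensorProduct.induction_on with
    | zero =>
      simp only [Completion.coe_zero, map_zero]
      exact zero_mem _
    | tmul p q => exact Submodule.subset_span ⟨(p, q), (hU p q).symm⟩
    | add s t hs ht =>
      simp only [Completion.coe_add, map_add]
      exact add_mem hs ht

/-- The value of a section at one of two equal points determines its value at the other. Together
with the associativity of `E`, this compares values of sections at `(xy)z` and at `x(yz)`. -/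
theorem eq_of_sigma_eq {s : ∀ x, E.fiber x} {x y : P} {p : E.fiber x} {q : E.fiber y}
    (h : (⟨x, p⟩ : Σ x, E.fiber x) = ⟨y, q⟩) (hs : s x = p) : s y = q := by
  obtain ⟨rfl, h⟩ := Sigma.mk.inj_iff.1 h
  rw [hs, eq_of_heq h]

end Multiplication

/-! ### Transport of sections along maps of the base -/

section Push

variable {P : Type v} [Mul P] {E : MulField.{u} P} {τ : P → P}

open Classical in
/-- The section with value `L y (s y)` at `τ y` and zero off the range of `τ`, for an injective map
`τ` of the base and linear maps `L y` between the fibres over `y` and `τ y`. -/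
def push (L : ∀ y, E.fiber y →ₗ[ℂ] E.fiber (τ y)) (s : ∀ x, E.fiber x) : ∀ x, E.fiber x :=
  -- the value is transported along the equality `τ y = x` of base points
  fun x => if h : ∃ y, τ y = x then h.choose_spec ▸ L h.choose (s h.choose) else 0

theorem push_apply (hτ : Function.Injective τ) (L : ∀ y, E.fiber y →ₗ[ℂ] E.fiber (τ y))
    (s : ∀ x, E.fiber x) (y : P) : push L s (τ y) = L y (s y) := by
  have h : ∃ z, τ z = τ y := ⟨y, rfl⟩
  have key : ∀ (z : P) (hz : τ z = τ y), (hz ▸ L z (s z) : E.fiber (τ y)) = L y (s y) := by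
    intro z hz
    obtain rfl := hτ hz
    rfl
  rw [push, dif_pos h]
  exact key _ _

theorem push_of_notMem (L : ∀ y, E.fiber y →ₗ[ℂ] E.fiber (τ y)) (s : ∀ x, E.fiber x) {x : P}
    (hx : x ∉ Set.range τ) : push L s x = 0 := dif_neg hx

/-- Sections that vanish off the range of `τ` are determined by their values on it. -/
theorem eq_of_range {s t : ∀ x, E.fiber x} (h : ∀ y, s (τ y) = t (τ y))
    (hs : ∀ x ∉ Set.range τ, s x = 0) (ht : ∀ x ∉ Set.range τ, t x = 0) : s = t := by
  funext x
  by_cases hx : x ∈ Set.range τ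
  · obtain ⟨y, rfl⟩ := hx
    exact h y
  · rw [hs x hx, ht x hx]

end Push

section Shift

variable {P : Type v} [MeasurableSpace P]

/-- An injective map of the base whose image of the measure `μ` is a multiple of the restriction of
`μ` to the range. -/
structure IsShift (μ : Measure P) (τ : P → P) (c : NNReal) : Prop where
  emb : MeasurableEmbedding τ
  ne_zero : c ≠ 0
  map_eq : μ.map τ = c • μ.restrict (Set.range τ)

variable {μ : Measure P} {τ : P → P} {c : NNReal} (hτ : IsShift μ τ c)
include hτ

theorem IsShift.integral_comp {G : Type*} [NormedAddCommGroup G] [NormedSpace ℝ G] {f : P → G}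
    (hf : ∀ x ∉ Set.range τ, f x = 0) : ∫ y, f (τ y) ∂μ = (c : ℝ) • ∫ x, f x ∂μ := by
  rw [← hτ.emb.integral_map, hτ.map_eq, integral_smul_nnreal_measure,
    setIntegral_eq_integral_of_forall_compl_eq_zero hf]
  rfl

theorem IsShift.integrable_comp_iff {f : P → ℝ}
    (hf : ∀ x ∉ Set.range τ, f x = 0) : Integrable (fun y => f (τ y)) μ ↔ Integrable f μ := by
  have h := hτ.emb.integrable_map_iff (μ := μ) (g := f)
  rw [Function.comp_def] at h
  rw [← h, hτ.map_eq, ENNReal.smul_def,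
    integrable_smul_measure (ENNReal.coe_ne_zero.2 hτ.ne_zero) ENNReal.coe_ne_top, ← IntegrableOn,
    integrableOn_iff_integrable_of_support_subset]
  intro x hx
  by_contra hx'
  exact hx (hf x hx')

theorem IsShift.integrable_comp {f : P → ℝ}
    (hf : Integrable f μ) : Integrable (fun y => f (τ y)) μ := by
  have h := hτ.emb.integrable_map_iff (μ := μ) (g := f)
  rw [Function.comp_def] at h
  rw [← h, hτ.map_eq, ENNReal.smul_def,
    integrable_smul_measure (ENNReal.coe_ne_zero.2 hτ.ne_zero) ENNReal.coe_ne_top]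
  exact hf.integrableOn

end Shift

/-! ### Square-integrable sections -/

section L2

variable {P : Type v} [Semigroup P] [MeasurableSpace P] {E : MulField.{u} P}

/-- The space of square-integrable measurable sections. -/
def sqIntegrable (hE : IsMeasurableField E) (μ : Measure P) : Submodule ℂ (∀ x, E.fiber x) where
  carrier := {s | s ∈ E.sections ∧ Integrable (fun x => ‖s x‖ ^ 2) μ}
  add_mem' := by
    rintro s t ⟨hs, hs'⟩ ⟨ht, ht'⟩
    refine ⟨hE.add_mem hs ht, ((hs'.add ht').const_mul 2).mono'
      (hE.norm_sq_measurable (hE.add_mem hs ht)).aestronglyMeasurable (.of_forall fun x => ?_)⟩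
    have h := norm_add_le (s x) (t x)
    have h' : ‖s x + t x‖ ^ 2 ≤ (‖s x‖ + ‖t x‖) ^ 2 := by gcongr
    simp only [Real.norm_eq_abs, abs_pow, abs_norm, Pi.add_apply]
    nlinarith [sq_nonneg (‖s x‖ - ‖t x‖)]
  zero_mem' := ⟨hE.zero_mem, by simp⟩
  smul_mem' := by
    rintro c s ⟨hs, hs'⟩
    refine ⟨hE.smul_mem hs measurable_const, ?_⟩
    simpa [norm_smul, mul_pow] using hs'.const_mul (‖c‖ ^ 2)

/-- Square-integrable measurable sections with the `L²` seminorm. Sections that agree almost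
everywhere are not identified, so that identities between sections hold at every point. -/
def L2Section (hE : IsMeasurableField E) (μ : Measure P) : Type (max u v) := sqIntegrable hE μ

namespace L2Section

variable {hE : IsMeasurableField E} {μ : Measure P}

instance : AddCommGroup (L2Section hE μ) := inferInstanceAs (AddCommGroup (sqIntegrable hE μ))

instance : Module ℂ (L2Section hE μ) := inferInstanceAs (Module ℂ (sqIntegrable hE μ))

/-- The underlying section. -/
def val : L2Section hE μ →ₗ[ℂ] (∀ x, E.fiber x) := (sqIntegrable hE μ).subtype

theorem val_mem (s : L2Section hE μ) : val s ∈ E.sections := s.2.1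

theorem integrable_norm_sq (s : L2Section hE μ) : Integrable (fun x => ‖val s x‖ ^ 2) μ := s.2.2

theorem ext_val {s t : L2Section hE μ} (h : val s = val t) : s = t := Subtype.ext h

theorem integrable_inner (s t : L2Section hE μ) : Integrable (fun x => ⟪val s x, val t x⟫_ℂ) μ := by
  refine (s.integrable_norm_sq.add t.integrable_norm_sq).mono'
    (hE.inner_measurable _ s.val_mem _ t.val_mem).aestronglyMeasurable (.of_forall fun x => ?_)
  have h := norm_inner_le_norm (𝕜 := ℂ) (val s x) (val t x)
  simp only [Pi.add_apply]
  nlinarith [sq_nonneg (‖val s x‖ - ‖val t x‖), sq_nonneg (‖val s x‖), sq_nonneg (‖val t x‖)]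

/-- The `L²` semi-inner product. -/
@[reducible]
def innerCore (hE : IsMeasurableField E) (μ : Measure P) :
    PreInnerProductSpace.Core ℂ (L2Section hE μ) where
  inner s t := ∫ x, ⟪val s x, val t x⟫_ℂ ∂μ
  conj_inner_symm s t := by
    rw [← integral_conj]
    simp only [inner_conj_symm]
  re_inner_nonneg s := by
    have h : ∀ x, ⟪val s x, val s x⟫_ℂ = ((‖val s x‖ ^ 2 : ℝ) : ℂ) := fun x => by
      rw [inner_self_eq_norm_sq_to_K]; simp
    simp only [h, integral_complex_ofReal]
    exact integral_nonneg fun x => sq_nonneg _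
  add_left s s' t := by
    simp only [map_add, Pi.add_apply, inner_add_left]
    exact integral_add (integrable_inner s t) (integrable_inner s' t)
  smul_left s t c := by
    simp only [map_smul, Pi.smul_apply, inner_smul_left]
    exact integral_const_mul _ _

instance : SeminormedAddCommGroup (L2Section hE μ) :=
  @InnerProductSpace.Core.toSeminormedAddCommGroup ℂ _ _ _ _ (innerCore hE μ)

instance : InnerProductSpace ℂ (L2Section hE μ) := InnerProductSpace.ofCore (innerCore hE μ)

theorem inner_def (s t : L2Section hE μ) : ⟪s, t⟫_ℂ = ∫ x, ⟪val s x, val t x⟫_ℂ ∂μ := rfl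

theorem norm_sq (s : L2Section hE μ) : ‖s‖ ^ 2 = ∫ x, ‖val s x‖ ^ 2 ∂μ := by
  have h : ((‖s‖ ^ 2 : ℝ) : ℂ) = ((∫ x, ‖val s x‖ ^ 2 ∂μ : ℝ) : ℂ) := by
    rw [← integral_complex_ofReal]
    have h' := inner_self_eq_norm_sq_to_K (𝕜 := ℂ) s
    rw [inner_def] at h'
    simp only [inner_self_eq_norm_sq_to_K] at h'
    simpa using h'.symm
  exact_mod_cast h

end L2Section

end L2

/-! ### Left and right multiplication on square-integrable sections -/

section Shifts

variable {P : Type v} [Semigroup P] [MeasurableSpace P] {E : MulField.{u} P}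

/-- A measurable field of multiples of linear isometries from the fibre over `y` to the fibre over
`τ y`, with a common factor. -/
structure ShiftMap (E : MulField.{u} P) (τ : P → P) where
  /-- the map from the fibre over `y` -/
  toLin : ∀ y, E.fiber y →ₗ[ℂ] E.fiber (τ y)
  /-- the factor -/
  scale : ℝ
  norm_eq : ∀ y q, ‖toLin y q‖ = scale * ‖q‖
  measurable : ∀ s ∈ E.sections, ∀ t ∈ E.sections,
    Measurable fun y => ⟪t (τ y), toLin y (s y)⟫_ℂ

variable {hE : IsMeasurableField E} {μ : Measure P} {τ : P → P} {c : NNReal}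

theorem push_mem_sections (hE : IsMeasurableField E) (hτ : MeasurableEmbedding τ)
    (L : ShiftMap E τ) {s : ∀ x, E.fiber x} (hs : s ∈ E.sections) :
    push L.toLin s ∈ E.sections := by
  refine hE.saturated _ fun t ht => ?_
  have h : (fun x => ⟪t x, push L.toLin s x⟫_ℂ) =
      Function.extend τ (fun y => ⟪t (τ y), L.toLin y (s y)⟫_ℂ) (fun _ => 0) := by
    funext x
    by_cases hx : ∃ y, τ y = x
    · obtain ⟨y, rfl⟩ := hx
      rw [hτ.injective.extend_apply, push_apply hτ.injective]
    · rw [Function.extend_apply' _ _ _ hx, push_of_notMem _ _ hx, inner_zero_right]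
  rw [h]
  exact hτ.measurable_extend (L.measurable s hs t ht) measurable_const

/-- Transport of square-integrable sections along a shift of the base. -/
def pushL2 (hτ : IsShift μ τ c) (L : ShiftMap E τ) : L2Section hE μ →ₗ[ℂ] L2Section hE μ where
  toFun s := ⟨push L.toLin (L2Section.val s), push_mem_sections hE hτ.emb L s.val_mem, by
    refine (hτ.integrable_comp_iff fun x hx => ?_).1 ?_
    · rw [push_of_notMem _ _ hx]; simp
    · simpa only [push_apply hτ.emb.injective, L.norm_eq, mul_pow] using
        s.integrable_norm_sq.const_mul _⟩
  map_add' s t := L2Section.ext_val <| eq_of_range (τ := τ)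
    (fun y => by
      change push L.toLin (L2Section.val (s + t)) (τ y) =
        push L.toLin (L2Section.val s) (τ y) + push L.toLin (L2Section.val t) (τ y)
      simp [push_apply hτ.emb.injective])
    (fun x hx => push_of_notMem _ _ hx)
    (fun x hx => by
      change push L.toLin (L2Section.val s) x + push L.toLin (L2Section.val t) x = 0
      rw [push_of_notMem _ _ hx, push_of_notMem _ _ hx, add_zero])
  map_smul' k s := L2Section.ext_val <| eq_of_range (τ := τ)
    (fun y => by
      change push L.toLin (L2Section.val (k • s)) (τ y) =
        k • push L.toLin (L2Section.val s) (τ y)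
      simp [push_apply hτ.emb.injective])
    (fun x hx => push_of_notMem _ _ hx)
    (fun x hx => by
      change k • push L.toLin (L2Section.val s) x = 0
      rw [push_of_notMem _ _ hx, smul_zero])

theorem val_pushL2_apply (hτ : IsShift μ τ c) (L : ShiftMap E τ) (s : L2Section hE μ) (y : P) :
    (pushL2 hτ L s).val (τ y) = L.toLin y (s.val y) := push_apply hτ.emb.injective _ _ y

theorem val_pushL2_of_notMem (hτ : IsShift μ τ c) (L : ShiftMap E τ) (s : L2Section hE μ) {x : P}
    (hx : x ∉ Set.range τ) : (pushL2 hτ L s).val x = 0 := push_of_notMem _ _ hx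

theorem inner_pushL2 (hτ : IsShift μ τ c) (L : ShiftMap E τ) (s t : L2Section hE μ) :
    (c : ℝ) • ⟪t, pushL2 hτ L s⟫_ℂ = ∫ y, ⟪t.val (τ y), L.toLin y (s.val y)⟫_ℂ ∂μ := by
  rw [L2Section.inner_def, ← hτ.integral_comp]
  · simp only [val_pushL2_apply]
  · intro x hx
    rw [val_pushL2_of_notMem hτ L s hx, inner_zero_right]

theorem inner_pushL2_pushL2 (hτ : IsShift μ τ c) (L L' : ShiftMap E τ) (s t : L2Section hE μ) :
    (c : ℝ) • ⟪pushL2 hτ L' t, pushL2 hτ L s⟫_ℂ =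
      ∫ y, ⟪L'.toLin y (t.val y), L.toLin y (s.val y)⟫_ℂ ∂μ := by
  rw [inner_pushL2]
  simp only [val_pushL2_apply]

/-- The mass that a transported section has in a set `A`. -/
theorem integral_indicator_pushL2 (hτ : IsShift μ τ c) (L : ShiftMap E τ) (s : L2Section hE μ)
    (A : Set P) :
    (c : ℝ) * ∫ x, A.indicator (fun x => ‖(pushL2 hτ L s).val x‖ ^ 2) x ∂μ =
      L.scale ^ 2 * ∫ y, (τ ⁻¹' A).indicator (fun y => ‖s.val y‖ ^ 2) y ∂μ := by
  rw [← smul_eq_mul, ← hτ.integral_comp, ← integral_const_mul]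
  · congr 1
    funext y
    by_cases hy : τ y ∈ A
    · rw [Set.indicator_of_mem hy, Set.indicator_of_mem (by exact hy), val_pushL2_apply,
        L.norm_eq, mul_pow]
    · rw [Set.indicator_of_notMem hy, Set.indicator_of_notMem (by exact hy), mul_zero]
  · intro x hx
    simp [Set.indicator, val_pushL2_of_notMem hτ L s hx]

variable [MeasurableSingletonClass P]

/-- Every vector of a fibre is the value of a measurable section. -/
theorem IsMeasurableField.exists_section (hE : IsMeasurableField E) {x : P} (u : E.fiber x) :
    ∃ s ∈ E.sections, s x = u := by
  classical
  refine ⟨Function.update (fun _ => 0) x u, hE.saturated _ fun t ht => ?_, by simp⟩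
  have h : (fun y => ⟪t y, (Function.update (fun _ => 0) x u : ∀ y, E.fiber y) y⟫_ℂ) =
      fun y => if y = x then ⟪t x, u⟫_ℂ else 0 := by
    funext y
    by_cases hy : y = x
    · subst hy; simp
    · simp [hy]
  rw [h]
  exact Measurable.ite (measurableSet_singleton x) measurable_const measurable_const

/-- Left multiplication by a vector. -/
def leftShift (hE : IsProductSystem E) {x : P} (u : E.fiber x) : ShiftMap E (x * ·) where
  toLin y := (mulL hE.algebraic x y u).toLinearMap
  scale := ‖u‖
  norm_eq y q := hE.algebraic.norm_mul u q
  measurable s hs t ht := by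
    obtain ⟨r, hr, rfl⟩ := hE.field.exists_section u
    exact (hE.mul_measurable r hr s hs t ht).comp measurable_prodMk_left

@[simp]
theorem leftShift_toLin (hE : IsProductSystem E) {x y : P} (u : E.fiber x) (q : E.fiber y) :
    (leftShift hE u).toLin y q = E.mul u q := rfl

/-- Right multiplication by a vector. -/
def rightShift (hE : IsProductSystem E) {a : P} (e : E.fiber a) : ShiftMap E (· * a) where
  toLin y :=
    { toFun := fun q => E.mul q e
      map_add' := fun p q => hE.algebraic.add_mul p q e
      map_smul' := fun c q => hE.algebraic.smul_mul c q e }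
  scale := ‖e‖
  norm_eq y q := (hE.algebraic.norm_mul q e).trans (mul_comm _ _)
  measurable s hs t ht := by
    obtain ⟨r, hr, rfl⟩ := hE.field.exists_section e
    exact (hE.mul_measurable s hs r hr t ht).comp measurable_prodMk_right

@[simp]
theorem rightShift_toLin (hE : IsProductSystem E) {a y : P} (e : E.fiber a) (q : E.fiber y) :
    (rightShift hE e).toLin y q = E.mul q e := rfl

variable (hP : ∀ x : P, IsShift μ (x * ·) 1)

/-- The representation of a product system by left multiplication on square-integrable
sections, for a left invariant measure. -/
def leftRep [SFinite μ] (hE : IsProductSystem E) : Rep E (L2Section hE.field μ) where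
  op x :=
    { toFun := fun u => pushL2 (hP x) (leftShift hE u)
      map_add' := fun u v => LinearMap.ext fun s => L2Section.ext_val <| by
        refine eq_of_range (τ := (x * ·)) (fun y => ?_)
          (fun z hz => val_pushL2_of_notMem (hP x) _ s hz) (fun z hz => ?_)
        · simp only [LinearMap.add_apply, map_add, Pi.add_apply, val_pushL2_apply (hP x),
            leftShift_toLin, hE.algebraic.add_mul]
        · simp only [LinearMap.add_apply, map_add, Pi.add_apply,
            val_pushL2_of_notMem (hP x) _ s hz, add_zero]
      map_smul' := fun k u => LinearMap.ext fun s => L2Section.ext_val <| by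
        refine eq_of_range (τ := (x * ·)) (fun y => ?_)
          (fun z hz => val_pushL2_of_notMem (hP x) _ s hz) (fun z hz => ?_)
        · simp only [LinearMap.smul_apply, map_smul, Pi.smul_apply, val_pushL2_apply (hP x),
            leftShift_toLin, hE.algebraic.smul_mul, RingHom.id_apply]
        · simp only [LinearMap.smul_apply, map_smul, Pi.smul_apply, RingHom.id_apply,
            val_pushL2_of_notMem (hP x) _ s hz, smul_zero] }
  inner_op x u v f g := by
    have h := inner_pushL2_pushL2 (hP x) (leftShift hE v) (leftShift hE u) g f
    simp only [leftShift_toLin, hE.algebraic.inner_mul, NNReal.coe_one, one_smul,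
      integral_const_mul] at h
    exact h
  op_mul x y u v f := L2Section.ext_val <| by
    refine eq_of_range (τ := (x * y * ·)) (fun z => ?_)
      (fun z hz => val_pushL2_of_notMem (hP (x * y)) _ f hz) (fun z hz => ?_)
    -- both sides are carried by `xyP`
    · refine (val_pushL2_apply (hP (x * y)) (leftShift hE (E.mul u v)) f z).trans (Eq.symm ?_)
      refine eq_of_sigma_eq (hE.algebraic.assoc u v (f.val z)).symm ?_
      refine (val_pushL2_apply (hP x) (leftShift hE u) _ (y * z)).trans ?_
      exact congrArg (E.mul u) (val_pushL2_apply (hP y) (leftShift hE v) f z)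
    · by_cases hzx : z ∈ Set.range (x * ·)
      · obtain ⟨w, rfl⟩ := hzx
        refine (val_pushL2_apply (hP x) (leftShift hE u) _ w).trans ?_
        have hw : w ∉ Set.range (y * ·) := by
          rintro ⟨t, rfl⟩
          exact hz ⟨t, mul_assoc x y t⟩
        exact (congrArg ((leftShift hE u).toLin w)
          (val_pushL2_of_notMem (hP y) (leftShift hE v) f hw)).trans (map_zero _)
      · exact val_pushL2_of_notMem (hP x) _ _ hzx
  measurable s hs f g := by
    have h : ∀ x, ⟪g, pushL2 (hP x) (leftShift hE (s x)) f⟫_ℂ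
        = ∫ y, ⟪g.val (x * y), E.mul (s x) (f.val y)⟫_ℂ ∂μ := fun x => by
      simpa using inner_pushL2 (hP x) (leftShift hE (s x)) f g
    have hm : Measurable fun x => ∫ y, ⟪g.val (x * y), E.mul (s x) (f.val y)⟫_ℂ ∂μ :=
      (StronglyMeasurable.integral_prod_right (f := fun x y =>
        ⟪g.val (x * y), E.mul (s x) (f.val y)⟫_ℂ)
        (hE.mul_measurable s hs _ f.val_mem _ g.val_mem).stronglyMeasurable).measurable
    exact (funext h ▸ hm :)

/-- Right multiplication by a vector of suitable norm is an isometry on square-integrable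
sections. -/
def rightIsometry (hE : IsProductSystem E) {a : P} (ha : IsShift μ (· * a) c) (e : E.fiber a)
    (he : ‖e‖ ^ 2 = c) : L2Section hE.field μ →ₗᵢ[ℂ] L2Section hE.field μ :=
  (pushL2 ha (rightShift hE e)).isometryOfInner fun s t => by
    have h := inner_pushL2_pushL2 ha (rightShift hE e) (rightShift hE e) t s
    simp only [rightShift_toLin, hE.algebraic.inner_mul, inner_self_eq_norm_sq_to_K,
      integral_mul_const] at h
    have hc : (c : ℂ) ≠ 0 := by exact_mod_cast ha.ne_zero
    have he' : ((‖e‖ : ℂ)) ^ 2 = (c : ℂ) := by exact_mod_cast congrArg (fun r : ℝ => (r : ℂ)) he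
    refine mul_left_cancel₀ hc ?_
    rw [L2Section.inner_def s t, mul_comm _ (∫ x, _ ∂μ), ← he']
    refine Eq.trans ?_ h
    rw [he']
    simp

theorem leftRep_rightIsometry [SFinite μ] (hE : IsProductSystem E) {a : P}
    (ha : IsShift μ (· * a) c) (e : E.fiber a) (he : ‖e‖ ^ 2 = c) (x : P) (u : E.fiber x)
    (s : L2Section hE.field μ) :
    (leftRep hP hE).op x u (rightIsometry hE ha e he s) =
      rightIsometry hE ha e he ((leftRep hP hE).op x u s) := by
  -- both sides are carried by `x P a`
  refine L2Section.ext_val (eq_of_range (τ := fun y => x * (y * a)) (fun y => ?_) ?_ ?_)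
  · refine (val_pushL2_apply (hP x) (leftShift hE u) _ (y * a)).trans (Eq.symm ?_)
    refine eq_of_sigma_eq (x := x * y * a) (p := E.mul (E.mul u (s.val y)) e) ?_ ?_
    · rw [hE.algebraic.assoc]
      refine congrArg (Sigma.mk (x * (y * a))) (congrArg (E.mul u) ?_)
      exact (val_pushL2_apply ha (rightShift hE e) s y).symm
    · refine (val_pushL2_apply ha (rightShift hE e) _ (x * y)).trans ?_
      exact congrArg (fun p => E.mul p e) (val_pushL2_apply (hP x) (leftShift hE u) s y)
  · intro z hz
    by_cases hzx : z ∈ Set.range (x * ·)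
    · obtain ⟨w, rfl⟩ := hzx
      have hw : w ∉ Set.range (· * a) := by
        rintro ⟨t, rfl⟩
        exact hz ⟨t, rfl⟩
      refine (val_pushL2_apply (hP x) (leftShift hE u) _ w).trans ?_
      exact (congrArg ((leftShift hE u).toLin w)
        (val_pushL2_of_notMem ha (rightShift hE e) s hw)).trans (map_zero _)
    · exact val_pushL2_of_notMem (hP x) _ _ hzx
  · intro z hz
    by_cases hza : z ∈ Set.range (· * a)
    · obtain ⟨w, rfl⟩ := hza
      have hw : w ∉ Set.range (x * ·) := by
        rintro ⟨t, rfl⟩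
        exact hz ⟨t, (mul_assoc x t a).symm⟩
      refine (val_pushL2_apply ha (rightShift hE e) _ w).trans ?_
      exact (congrArg ((rightShift hE e).toLin w)
        (val_pushL2_of_notMem (hP x) (leftShift hE u) s hw)).trans (map_zero _)
    · exact val_pushL2_of_notMem ha _ _ hza

end Shifts

/-! ### Nondegeneracy in the limit -/

section Nondegenerate

variable {P : Type v} [Semigroup P] [MeasurableSpace P] [MeasurableSingletonClass P]
  {E : MulField.{u} P} {μ : Measure P} {c : NNReal}

/-- The section `y ↦ (u ·)* s(xy)`, the adjoint of left multiplication by `u` applied to `s`. -/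
def contract (hE : IsProductSystem E) {x : P} (hx : IsShift μ (x * ·) 1) (u : E.fiber x)
    (s : L2Section hE.field μ) : L2Section hE.field μ :=
  have := hE.algebraic.complete
  have hmem : (fun y => ContinuousLinearMap.adjoint (mulL hE.algebraic x y u) (s.val (x * y)))
      ∈ E.sections := hE.field.saturated _ fun t ht => by
    have h := Complex.continuous_conj.measurable.comp
      ((leftShift hE u).measurable t ht s.val s.val_mem)
    simp only [Function.comp_def, inner_conj_symm] at h
    simp only [ContinuousLinearMap.adjoint_inner_right]
    exact h
  ⟨fun y => ContinuousLinearMap.adjoint (mulL hE.algebraic x y u) (s.val (x * y)), hmem, by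
    refine ((hx.integrable_comp s.integrable_norm_sq).const_mul (‖u‖ ^ 2)).mono'
      (hE.field.norm_sq_measurable hmem).aestronglyMeasurable (.of_forall fun y => ?_)
    rw [Real.norm_eq_abs, abs_pow, abs_norm, ← mul_pow]
    gcongr
    refine ContinuousLinearMap.le_of_opNorm_le _ ?_ _
    rw [LinearIsometryEquiv.norm_map]
    exact ContinuousLinearMap.opNorm_le_bound _ (norm_nonneg _)
      fun q => (hE.algebraic.norm_mul u q).le⟩

/-- The span of the ranges of left multiplication by the vectors over `x` is dense in the sections
carried by `xP`: a section is as close to this span as its mass off `xP` allows. -/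
theorem exists_span_norm_sub_lt [SFinite μ] (hE : IsProductSystem E)
    (hP : ∀ x : P, IsShift μ (x * ·) 1) (x : P) (s : L2Section hE.field μ) {ε : ℝ} (hε : 0 < ε)
    (hs : ∫ z, (Set.range (x * ·))ᶜ.indicator (fun z => ‖s.val z‖ ^ 2) z ∂μ < ε ^ 2) :
    ∃ g ∈ Submodule.span ℂ (Set.range fun p : E.fiber x × L2Section hE.field μ =>
      (leftRep hP hE).op x p.1 p.2), ‖s - g‖ < ε := by
  have hcomplete := hE.algebraic.complete
  obtain ⟨b', -, hb'⟩ := hE.field.exists_basis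
  obtain ⟨b, hb⟩ : ∃ b : ℕ → E.fiber x, IsPaddedBasis b := ⟨_, hb' x⟩
  -- partial sums of `s(xy) = ∑ₙ bₙ (bₙ* s(xy))`
  let Q : ℕ → L2Section hE.field μ := fun N => ∑ n ∈ Finset.range N,
    (leftRep hP hE).op x (b n) (contract hE (hP x) (b n) s)
  have hQ : ∀ N y, (Q N).val (x * y) = ∑ n ∈ Finset.range N, mulL hE.algebraic x y (b n)
      (ContinuousLinearMap.adjoint (mulL hE.algebraic x y (b n)) (s.val (x * y))) := by
    intro N y
    rw [map_sum, Finset.sum_apply]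
    exact Finset.sum_congr rfl fun n _ =>
      val_pushL2_apply (hP x) (leftShift hE (b n)) (contract hE (hP x) (b n) s) y
  have hQ0 : ∀ N z, z ∉ Set.range (x * ·) → (Q N).val z = 0 := by
    intro N z hz
    rw [map_sum, Finset.sum_apply]
    exact Finset.sum_eq_zero fun n _ => val_pushL2_of_notMem (hP x) _ _ hz
  have hlim : Tendsto (fun N => ‖s - Q N‖ ^ 2) atTop
      (𝓝 (∫ z, (Set.range (x * ·))ᶜ.indicator (fun z => ‖s.val z‖ ^ 2) z ∂μ)) := by
    simp only [L2Section.norm_sq]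
    refine tendsto_integral_of_dominated_convergence (fun z => 4 * ‖s.val z‖ ^ 2)
      (fun N => (s - Q N).integrable_norm_sq.aestronglyMeasurable)
      (s.integrable_norm_sq.const_mul 4) (fun N => .of_forall fun z => ?_)
      (.of_forall fun z => ?_)
    · have h : ‖(Q N).val z‖ ≤ ‖s.val z‖ := by
        by_cases hz : z ∈ Set.range (x * ·)
        · obtain ⟨y, rfl⟩ := hz
          simp only [hQ]
          exact (isTensor_mulL hE.algebraic x y).norm_sum_le hb _ _
        · rw [hQ0 N z hz, norm_zero]; exact norm_nonneg _
      have h2 := norm_sub_le (s.val z) ((Q N).val z)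
      rw [map_sub, Pi.sub_apply, Real.norm_eq_abs, abs_pow, abs_norm]
      have h3 : ‖s.val z - (Q N).val z‖ ≤ 2 * ‖s.val z‖ := by linarith
      calc ‖s.val z - (Q N).val z‖ ^ 2 ≤ (2 * ‖s.val z‖) ^ 2 := by gcongr
        _ = 4 * ‖s.val z‖ ^ 2 := by ring
    · simp only [map_sub, Pi.sub_apply]
      by_cases hz : z ∈ Set.range (x * ·)
      · rw [Set.indicator_of_notMem (by simpa using hz)]
        obtain ⟨y, rfl⟩ := hz
        simp only [hQ]
        have h := ((isTensor_mulL hE.algebraic x y).hasSum hb (s.val (x * y))).tendsto_sum_nat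
        simpa using ((tendsto_const_nhds (x := s.val (x * y))).sub h).norm.pow 2
      · rw [Set.indicator_of_mem (by simpa using hz)]
        simp [hQ0 _ z hz]
  obtain ⟨N, hN⟩ := (hlim.eventually_lt_const hs).exists
  exact ⟨Q N, sum_mem fun n _ => Submodule.subset_span ⟨(b n, contract hE (hP x) (b n) s), rfl⟩,
    lt_of_pow_lt_pow_left₀ 2 hε.le hN⟩

/-- The mass in a set `A` of an iterate of the right isometry is the mass in the set of points that
the corresponding iterate of right translation sends into `A`. -/
theorem integral_indicator_rightIsometry_pow (hE : IsProductSystem E) {a : P}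
    (ha : IsShift μ (· * a) c) (e : E.fiber a) (he : ‖e‖ ^ 2 = c) (s : L2Section hE.field μ)
    (n : ℕ) (A : Set P) :
    ∫ x, A.indicator (fun x =>
        ‖(((rightIsometry hE ha e he).toLinearMap ^ n) s).val x‖ ^ 2) x ∂μ =
      ∫ y, ((· * a)^[n] ⁻¹' A).indicator (fun y => ‖s.val y‖ ^ 2) y ∂μ := by
  induction n generalizing A with
  | zero => rfl
  | succ n ih =>
    have hc : (c : ℝ) ≠ 0 := by exact_mod_cast ha.ne_zero
    have h := integral_indicator_pushL2 ha (rightShift hE e)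
      (((rightIsometry hE ha e he).toLinearMap ^ n) s) A
    rw [show (rightShift hE e).scale ^ 2 = c from he] at h
    rw [pow_succ']
    refine (mul_left_cancel₀ hc h).trans ((ih _).trans ?_)
    rw [← Set.preimage_comp, ← Function.iterate_succ' ]

/-- Iterates of the right isometry concentrate on `xP`, because `y aⁿ` lies in `xP` for large
`n`. -/
theorem tendsto_integral_rightIsometry_pow (hE : IsProductSystem E) {a : P}
    (ha : IsShift μ (· * a) c) (e : E.fiber a) (he : ‖e‖ ^ 2 = c) {x : P}
    (hx : MeasurableEmbedding (x * ·))
    (habs : ∀ y, ∀ᶠ n in atTop, (· * a)^[n] y ∈ Set.range (x * ·)) (s : L2Section hE.field μ) :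
    Tendsto (fun n => ∫ z, (Set.range (x * ·))ᶜ.indicator (fun z =>
      ‖(((rightIsometry hE ha e he).toLinearMap ^ n) s).val z‖ ^ 2) z ∂μ) atTop (𝓝 0) := by
  simp only [integral_indicator_rightIsometry_pow]
  rw [← integral_zero P ℝ (μ := μ)]
  refine tendsto_integral_of_dominated_convergence (fun y => ‖s.val y‖ ^ 2) (fun n => ?_)
    s.integrable_norm_sq (fun n => .of_forall fun y => ?_) (.of_forall fun y => ?_)
  · exact s.integrable_norm_sq.aestronglyMeasurable.indicator
      ((ha.emb.measurable.iterate n) hx.measurableSet_range.compl)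
  · rw [Real.norm_eq_abs, abs_of_nonneg (Set.indicator_nonneg (fun _ _ => sq_nonneg _) _)]
    exact Set.indicator_le_self' (fun _ _ => sq_nonneg _) _
  · refine tendsto_const_nhds.congr' ?_
    filter_upwards [habs y] with n hn
    rw [Set.indicator_of_notMem]
    simpa using hn

end Nondegenerate

/-! ### Separability and non-triviality -/

section Separable

variable {P : Type v} [Semigroup P] [MeasurableSpace P] {E : MulField.{u} P} {μ : Measure P}

/-- The coefficients of a section with respect to a measurable field of orthonormal bases embed
square-integrable sections isometrically into a scalar `L²` space. -/
theorem separableSpace_L2Section [MeasurableSpace.CountablyGenerated P] [SFinite μ]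
    (hE : IsMeasurableField E) (hcomplete : ∀ x, CompleteSpace (E.fiber x)) :
    TopologicalSpace.SeparableSpace (L2Section hE μ) := by
  obtain ⟨b, hb, hbx⟩ := hE.exists_basis
  let T : L2Section hE μ → P × ℕ → ℂ := fun s p => ⟪b p.2 p.1, s.val p.1⟫_ℂ
  have hTm : ∀ s, Measurable (T s) := fun s =>
    measurable_from_prod_countable_left fun n => hE.inner_measurable _ (hb n) _ s.val_mem
  have hsum : ∀ (s : L2Section hE μ) x,
      ∑' n, ‖T s (x, n)‖ₑ ^ 2 = ENNReal.ofReal (‖s.val x‖ ^ 2) := by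
    intro s x
    have h := (hbx x).hasSum_norm_sq (s.val x)
    rw [← h.tsum_eq, ENNReal.ofReal_tsum_of_nonneg (fun _ => sq_nonneg _) h.summable]
    refine tsum_congr fun n => ?_
    rw [ENNReal.ofReal_pow (norm_nonneg _), ofReal_norm]
  have hint : ∀ s : L2Section hE μ,
      ∫⁻ p, ‖T s p‖ₑ ^ 2 ∂(μ.prod Measure.count) = ENNReal.ofReal (‖s‖ ^ 2) := by
    intro s
    rw [lintegral_prod _ ((hTm s).enorm.pow_const 2).aemeasurable, L2Section.norm_sq,
      ofReal_integral_eq_lintegral_ofReal s.integrable_norm_sq (.of_forall fun _ => sq_nonneg _)]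
    exact lintegral_congr fun x => by rw [lintegral_count, hsum]
  have hnorm : ∀ s, eLpNorm (T s) 2 (μ.prod Measure.count) = ENNReal.ofReal ‖s‖ := by
    intro s
    rw [eLpNorm_eq_lintegral_rpow_enorm_toReal (by simp) (by simp)]
    simp only [ENNReal.toReal_ofNat, ENNReal.rpow_ofNat]
    rw [hint, ENNReal.ofReal_pow (norm_nonneg _), ← ENNReal.rpow_natCast, ← ENNReal.rpow_mul]
    simp
  have hmem : ∀ s, MemLp (T s) 2 (μ.prod Measure.count) := fun s =>
    ⟨(hTm s).aestronglyMeasurable, by rw [hnorm]; exact ENNReal.ofReal_lt_top⟩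
  let Φ : L2Section hE μ →ₗᵢ[ℂ] Lp ℂ 2 (μ.prod (Measure.count : Measure ℕ)) :=
    { toFun := fun s => (hmem s).toLp
      map_add' := fun s t => by
        rw [← MemLp.toLp_add]
        congr 1
        funext p
        simp [T]
      map_smul' := fun k s => by
        rw [RingHom.id_apply, ← MemLp.toLp_const_smul]
        congr 1
        funext p
        simp [T]
      norm_map' := fun s => by
        change ‖(hmem s).toLp‖ = _
        rw [Lp.norm_toLp, hnorm, ENNReal.toReal_ofReal (norm_nonneg _)] }
  have : Fact ((2 : ENNReal) ≠ ⊤) := ⟨by simp⟩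
  have : SecondCountableTopology (L2Section hE μ) :=
    Φ.isometry.isUniformInducing.isInducing.secondCountableTopology
  infer_instance

/-- A basis section that is non-zero on a set of positive measure, cut off to a subset of finite
measure, is a square-integrable section of non-zero norm. -/
theorem exists_norm_ne_zero_L2Section [SigmaFinite μ] [NeZero μ]
    (hE : IsMeasurableField E) (hcomplete : ∀ x, CompleteSpace (E.fiber x))
    (hne : ∀ x, Nontrivial (E.fiber x)) :
    ∃ s : L2Section hE μ, ‖s‖ ≠ 0 := by
  obtain ⟨b, hb, hbx⟩ := hE.exists_basis
  have hex : ∀ x, ∃ n, b n x ≠ 0 := by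
    intro x
    by_contra! h
    obtain ⟨z, hz⟩ := exists_ne (0 : E.fiber x)
    have h1 := ((hbx x).hasSum_norm_sq z).tsum_eq
    simp only [h, inner_zero_left, norm_zero, ne_eq, OfNat.ofNat_ne_zero, not_false_eq_true,
      zero_pow, tsum_zero] at h1
    exact hz (norm_eq_zero.1 (pow_eq_zero_iff two_ne_zero |>.1 h1.symm))
  obtain ⟨n, hn⟩ : ∃ n, μ {x | b n x ≠ 0} ≠ 0 := by
    by_contra! h
    have h1 := measure_iUnion_null h
    have h2 : ⋃ n, {x | b n x ≠ 0} = Set.univ := Set.iUnion_eq_univ_iff.2 hex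
    rw [h2] at h1
    exact NeZero.ne μ (Measure.measure_univ_eq_zero.1 h1)
  have hm : MeasurableSet {x | b n x ≠ 0} := by
    have : {x | b n x ≠ 0} = {x | ‖b n x‖ ≠ 0} := by simp
    rw [this]
    exact (hE.norm_measurable (hb n)) (measurableSet_singleton 0).compl
  obtain ⟨A, hAm, hAsub, hA0, hAtop⟩ : ∃ A, MeasurableSet A ∧ A ⊆ {x | b n x ≠ 0} ∧ 0 < μ A ∧
      μ A < ⊤ := by
    obtain ⟨A, h1, h2, h3, h4⟩ := Measure.exists_subset_measure_lt_top hm (pos_iff_ne_zero.2 hn)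
    exact ⟨A, h1, h2, h3, h4⟩
  have hnorm : ∀ x, ‖A.indicator (fun _ => (1 : ℂ)) x • b n x‖ ^ 2 = A.indicator 1 x := by
    intro x
    by_cases hx : x ∈ A
    · simp [hx, (hbx x).norm_eq_one n (hAsub hx)]
    · simp [hx]
  let s : L2Section hE μ := ⟨fun x => A.indicator (fun _ => (1 : ℂ)) x • b n x,
    hE.smul_mem (hb n) (measurable_const.indicator hAm), by
      simp only [hnorm]
      exact (integrable_indicator_iff hAm).2 (integrableOn_const hAtop.ne)⟩
  refine ⟨s, fun h => ?_⟩
  have h1 : ‖s‖ ^ 2 = μ.real A := by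
    rw [L2Section.norm_sq]
    refine (integral_congr_ae (.of_forall hnorm)).trans ?_
    simp [integral_indicator hAm]
  rw [h] at h1
  have : 0 < μ.real A := ENNReal.toReal_pos hA0.ne' hAtop.ne
  simp at h1
  linarith

end Separable

/-! ### Concreteness over semigroups with an absorbing element -/

section Main

variable {P : Type v} [Semigroup P] [MeasurableSpace P] [MeasurableSingletonClass P]
  [MeasurableSpace.CountablyGenerated P] {E : MulField.{u} P} {μ : Measure P} {c : NNReal}

/-- Every product system is concrete over a semigroup that carries a left invariant measure scaled
by right translation by an element `a` whose powers eventually move every point into every right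
ideal `xP`. -/
theorem isConcrete_of_absorbing [SigmaFinite μ] [NeZero μ] (hE : IsProductSystem E)
    (hP : ∀ x : P, IsShift μ (x * ·) 1) {a : P} (ha : IsShift μ (· * a) c)
    (habs : ∀ x y, ∀ᶠ n in atTop, (· * a)^[n] y ∈ Set.range (x * ·)) : IsConcrete E := by
  have := hE.algebraic.nonzero a
  obtain ⟨e, he⟩ := exists_norm_eq (E.fiber a) (Real.sqrt_nonneg c)
  have he' : ‖e‖ ^ 2 = c := by rw [he, Real.sq_sqrt c.coe_nonneg]
  have := separableSpace_L2Section (μ := μ) hE.field hE.algebraic.complete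
  have hnd : ((leftRep hP hE).dirLim (leftRep_rightIsometry hP hE ha e he')).IsNondegenerate := by
    refine Rep.dirLim_isNondegenerate _ fun x s ε hε => ?_
    have hlim := tendsto_integral_rightIsometry_pow hE ha e he' (hP x).emb (habs x) s
    obtain ⟨n, hn⟩ := (hlim.eventually_lt_const (pow_pos hε 2)).exists
    exact ⟨n, exists_span_norm_sub_lt hE hP x _ hε hn⟩
  obtain ⟨s, hs⟩ := exists_norm_ne_zero_L2Section (μ := μ) hE.field hE.algebraic.complete
    hE.algebraic.nonzero
  exact Rep.isConcrete_of_separable hnd ⟨DirLim.of 0 s, by rwa [DirLim.norm_of]⟩ hE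

end Main

/-! ### Subsemigroups of locally compact groups -/

section Group

variable {G : Type v} [Group G] {P : Subsemigroup G}

theorem val_iterate_mul_right (a y : P) (n : ℕ) :
    (((· * a)^[n] y : P) : G) = (y : G) * (a : G) ^ n := by
  induction n with
  | zero => simp
  | succ n ih =>
    rw [Function.iterate_succ_apply', MulMemClass.coe_mul, ih, pow_succ, mul_assoc]

theorem mul_pow_mem_subsemigroup {a b : G} (ha : a ∈ P) (hb : b ∈ P) (n : ℕ) :
    b * a ^ n ∈ P := by
  induction n with
  | zero => simpa
  | succ n ih => rw [pow_succ, ← mul_assoc]; exact P.mul_mem ih ha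

/-- If `PP⁻¹` is a group, then the powers of an order unit move every point of `P` into every right
ideal `xP`: writing `x⁻¹y = pq⁻¹` and `aⁿ = qb` gives `yaⁿ = x(pb)`. -/
theorem eventually_iterate_mem_range {K : Subgroup G}
    (hK : (K : Set G) = (P : Set G) * (P : Set G)⁻¹) {a : P} (ha : IsOrderUnit P (a : G))
    (x y : P) : ∀ᶠ n in atTop, (· * a)^[n] y ∈ Set.range (x * ·) := by
  have hPK : ∀ p : P, (p : G) ∈ K := by
    intro p
    rw [← SetLike.mem_coe, hK]
    exact ⟨p * p, P.mul_mem p.2 p.2, (p : G)⁻¹, Set.inv_mem_inv.2 p.2, by group⟩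
  have hxy : (x : G)⁻¹ * y ∈ (K : Set G) := K.mul_mem (K.inv_mem (hPK x)) (hPK y)
  rw [hK] at hxy
  obtain ⟨p, hp, q', hq', h⟩ := hxy
  obtain ⟨n, -, b, hb, hn⟩ := ha.2 q'⁻¹ hq'
  filter_upwards [eventually_ge_atTop n] with m hm
  refine ⟨⟨p * (b * (a : G) ^ (m - n)), P.mul_mem hp (mul_pow_mem_subsemigroup a.2 hb _)⟩,
    Subtype.ext ?_⟩
  rw [val_iterate_mul_right]
  have hm' : (a : G) ^ m = q'⁻¹ * b * (a : G) ^ (m - n) := by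
    rw [← hn, ← pow_add, Nat.add_sub_cancel' hm]
  have hy : (y : G) = x * (p * q') := by
    rw [show p * q' = (x : G)⁻¹ * y from h, mul_inv_cancel_left]
  rw [hm', hy]
  simp [mul_assoc]

variable [MeasurableSpace G]

/-- A measurable bijection of the group that scales a measure and maps the subsemigroup into
itself restricts to a shift of the subsemigroup. -/
theorem isShift_comap_subtype (hP : MeasurableSet (P : Set G)) {ν : Measure G} {c : NNReal}
    (hc : c ≠ 0) {σ : G ≃ᵐ G} (hσ : ν.map σ = c • ν) {τ : P → P} (hτ : ∀ y, (τ y : G) = σ y) :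
    IsShift (ν.comap ((↑) : P → G)) τ c := by
  have hval : MeasurableEmbedding ((↑) : P → G) := MeasurableEmbedding.subtype_coe hP
  have hcomp : ((↑) : P → G) ∘ τ = σ ∘ (↑) := funext hτ
  have hemb : MeasurableEmbedding τ :=
    { injective := Function.Injective.of_comp (f := ((↑) : P → G))
        (by rw [hcomp]; exact σ.injective.comp hval.injective)
      measurable := hval.measurable_comp_iff.1
        (by rw [hcomp]; exact σ.measurable.comp hval.measurable)
      measurableSet_image' := fun s hs => by
        rw [← hval.measurableSet_image, ← Set.image_comp, hcomp, Set.image_comp,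
          σ.measurableEmbedding.measurableSet_image, hval.measurableSet_image]
        exact hs }
  refine ⟨hemb, hc, Measure.ext fun s hs => ?_⟩
  have himg : ((↑) : P → G) '' (s ∩ Set.range τ) = σ '' (((↑) : P → G) '' (τ ⁻¹' s)) := by
    rw [← Set.image_preimage_eq_inter_range, ← Set.image_comp, ← Set.image_comp, hcomp]
  rw [Measure.map_apply hemb.measurable hs, Measure.smul_apply, Measure.restrict_apply hs,
    hval.comap_apply, hval.comap_apply, himg]
  have h := congrArg (fun m : Measure G => m (σ '' (((↑) : P → G) '' (τ ⁻¹' s)))) hσ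
  simp only [Measure.smul_apply] at h
  rw [← h, σ.map_apply, Set.preimage_image_eq _ σ.injective]

end Group

end ProdSys

end

theorem mainTheorem6 {G : Type*} [Group G] [TopologicalSpace G] [IsTopologicalGroup G]
    [LocallyCompactSpace G] [SecondCountableTopology G] [T2Space G]
    [MeasurableSpace G] [BorelSpace G]
    (P : Subsemigroup G) (hP_borel : MeasurableSet (P : Set G))
    (hP_int : (interior (P : Set G)).Nonempty)
    (hP_ore : ∃ K : Subgroup G, (K : Set G) = (P : Set G) * (P : Set G)⁻¹)
    (hP_unit : ∃ a : G, ProdSys.IsOrderUnit P a)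
    (E : ProdSys.MulField P) (hE : ProdSys.IsProductSystem E) :
    ProdSys.IsConcrete E := by
  obtain ⟨K, hK⟩ := hP_ore
  obtain ⟨a, ha⟩ := hP_unit
  let ν : MeasureTheory.Measure G := MeasureTheory.Measure.haar
  have hval : MeasurableEmbedding ((↑) : P → G) := MeasurableEmbedding.subtype_coe hP_borel
  let μ : MeasureTheory.Measure P := ν.comap (↑)
  have hσ : MeasureTheory.SigmaFinite μ :=
    .of_map μ hval.measurable.aemeasurable (by rw [hval.map_comap]; infer_instance)
  have hμ : NeZero μ := ⟨fun h => by
    have h1 : μ Set.univ = ν P := by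
      rw [hval.comap_apply, Set.image_univ, Subtype.range_coe_subtype]
      rfl
    have h2 : 0 < ν P := (isOpen_interior.measure_pos ν hP_int).trans_le
      (MeasureTheory.measure_mono interior_subset)
    rw [← h1, h] at h2
    simp at h2⟩
  have hleft : ∀ x : P, ProdSys.IsShift μ (x * ·) 1 := fun x =>
    ProdSys.isShift_comap_subtype hP_borel one_ne_zero (σ := MeasurableEquiv.mulLeft (x : G))
      (by rw [one_smul]; exact MeasureTheory.map_mul_left_eq_self ν (x : G)) fun y => rfl
  -- right translates of Haar measure are left invariant, hence multiples of it
  let ν' : MeasureTheory.Measure G := ν.map (· * a)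
  have hν' : ν' = ν'.haarScalarFactor ν • ν :=
    MeasureTheory.Measure.isMulLeftInvariant_eq_smul ν' ν
  have hright : ProdSys.IsShift μ (· * (⟨a, ha.1⟩ : P)) (ν'.haarScalarFactor ν) :=
    ProdSys.isShift_comap_subtype hP_borel
      (MeasureTheory.Measure.haarScalarFactor_pos_of_isHaarMeasure ν' ν).ne'
      (σ := MeasurableEquiv.mulRight a) hν' fun y => rfl
  exact ProdSys.isConcrete_of_absorbing hE hleft hright
    (ProdSys.eventually_iterate_mem_range hK ha)
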